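/- \textbf{Theorem.} A \emph{model} is a choice of multiplicities $a_{u,v}\in\mathbb C$ for $(u,v)\in\{-1,0,1\}^2\setminus\{(0,0)\}$. Its generating function is $f(x,y,t)=\sum_{n,i,j\ge 0}f_{i,j,n}x^iy^jt^n\in\mathbb C[x,y][[t]]$, where $f_{0,0,0}=1$, $f_{i,j,0}=0$ for $(i,j)\ne(0,0)$, $f_{i,j,n}=0$ if $i<0$ or $j<0$, and $f_{i,j,n+1}=\sum_{u,v}a_{u,v}f_{i-u,j-v,n}$ for $i,j,n\ge0$. The model is \emph{interesting} if none of the four triples $(a_{1,-1},a_{1,0},a_{1,1})$, $(a_{-1,1},a_{0,1},a_{1,1})$, $(a_{-1,-1},a_{-1,0},a_{-1,1})$, $(a_{-1,-1},a_{0,-1},a_{1,-1})$ is zero. For an interesting model let $G=\langle\Phi,\Psi\rangle$ be the group of automorphisms of the field $\mathbb C(x,y)$ over $\mathbb C$ generated by \[\Phi\colon(x,y)\mapsto\Bigl(\frac1x\,\frac{\sum_v a_{-1,v}y^v}{\sum_v a_{1,v}y^v},\,y\Bigr),\qquad \Psi\colon(x,y)\mapsto\Bigl(x,\,\frac1y\,\frac{\sum_u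 a_{u,-1}x^u}{\sum_u a_{u,1}x^u}\Bigr).\] Then, for every interesting model: (1) $G$ is the dihedral group $D_4$ with four elements if and only if there is $\lambda\in\mathbb C\setminus\{0\}$ such that $a_{-1,v}=\lambda a_{1,v}$ for $v=-1,0,1$, or, for the model reflected about the diagonal $x=y$, such that $a_{v,-1}=\lambda a_{v,1}$ for $v=-1,0,1$. (2) If $G$ is $D_4$, then $f$ is D-finite, that is, as a power series in $t$ over $\mathbb C[x,y]$ it satisfies a nontrivial linear ordinary differential equation in $t$ whose coefficients are polynomials in $t$ over $\mathbb C[x,y]$. (3) If $a_{-1,v}=\lambda a_{1,v}$ for $v=-1,0,1$ with $\lambda\neq0$, then, with $K(x,y,t)=1-t\sum_{u,v}a_{u,v}x^uy^v$, \[f(x,y,t)=\frac1{xy}[x^>][y^>]\,\frac{(x^2-\lambda)\bigl(a_{0,1}xy^2-a_{0,-1}x-(\lambda+x^2)(a_{1,-1}-a_{1,1}y^2)\bigr)}{xy\,\bigl(a_{1,1}(\lambda+x^2)+a_{0,1}x\bigr)K(x,y,t)}.\] Here the rational function is expanded in $\mathbb C(x)[y,y^{-1}][[t]]$, the operator $[y^>]$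 keeps the terms with positive exponent of $y$, the result lies in $\mathbb C[x,x^{-1}][y,y^{-1}][[t]]$, and $[x^>]$ keeps the terms with positive exponent of $x$. -/

import Mathlib

open scoped LaurentPolynomial PowerSeries

namespace QuarterPlane

/-! ### Models and their generating functions -/

/-- A model: a choice of a complex multiplicity `a u v` for each direction `(u, v)`.
Only the eight directions `(u, v) ∈ {-1, 0, 1}² \ {(0, 0)}` are ever used. -/
abbrev Model : Type := ℤ → ℤ → ℂ

/-- The eight directions `{-1, 0, 1}² \ {(0, 0)}`. -/
def directions : Finset (ℤ × ℤ) :=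
  {(-1, -1), (-1, 0), (-1, 1), (0, -1), (0, 1), (1, -1), (1, 0), (1, 1)}

/-- Reflection of a model about the diagonal `x = y`. -/
def Model.reflect (a : Model) : Model := fun u v => a v u

/-- One of the four sides of the step set carries only multiplicities `0`. -/
def Uninteresting (a : Model) : Prop :=
  (a 1 (-1) = 0 ∧ a 1 0 = 0 ∧ a 1 1 = 0) ∨
  (a (-1) 1 = 0 ∧ a 0 1 = 0 ∧ a 1 1 = 0) ∨
  (a (-1) (-1) = 0 ∧ a (-1) 0 = 0 ∧ a (-1) 1 = 0) ∨
  (a (-1) (-1) = 0 ∧ a 0 (-1) = 0 ∧ a 1 (-1) = 0)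

/-- The interesting models. -/
def Interesting (a : Model) : Prop := ¬ Uninteresting a

/-- `walks a n i j` is the (weighted) number `f_{i,j,n}` of walks with `n` steps from the origin to
`(i, j)` which stay in the quarter plane; it is `0` whenever `i < 0` or `j < 0`. -/
noncomputable def walks (a : Model) : ℕ → ℤ → ℤ → ℂ
  | 0, i, j => if i = 0 ∧ j = 0 then 1 else 0
  | n + 1, i, j =>
    if 0 ≤ i ∧ 0 ≤ j then ∑ d ∈ directions, a d.1 d.2 * walks a n (i - d.1) (j - d.2) else 0

/-- A walk with `n` steps cannot leave the square `[0, n]²`. -/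
theorem walks_eq_zero (a : Model) (n : ℕ) (i j : ℤ) (h : (n : ℤ) < i ∨ (n : ℤ) < j) :
    walks a n i j = 0 := by
  induction n generalizing i j with
  | zero => rw [walks, if_neg]; push_cast at h; omega
  | succ n ih =>
    rw [walks]
    split_ifs
    · refine Finset.sum_eq_zero fun d hd => ?_
      have hd' : d.1 ≤ 1 ∧ d.2 ≤ 1 := by
        revert d; decide
      rw [ih, mul_zero]
      push_cast at h
      omega
    · rfl

/-- The ring `ℂ[x, y]`; the variables are `X 0 = x` and `X 1 = y`. -/
abbrev Poly : Type := MvPolynomial (Fin 2) ℂ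

/-- The generating function `f(x, y, t) = ∑_{n,i,j} f_{i,j,n} x^i y^j t^n ∈ ℂ[x, y][[t]]`. -/
noncomputable def genFun (a : Model) : Poly⟦X⟧ :=
  PowerSeries.mk fun n => ∑ i ∈ Finset.range (n + 1), ∑ j ∈ Finset.range (n + 1),
    MvPolynomial.C (walks a n i j) * MvPolynomial.X 0 ^ i * MvPolynomial.X 1 ^ j

theorem coeff_genFun (a : Model) (n : ℕ) (m : Fin 2 →₀ ℕ) :
    MvPolynomial.coeff m (PowerSeries.coeff n (genFun a)) = walks a n (m 0) (m 1) := by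
  have hmon : ∀ i j : ℕ, (MvPolynomial.C (walks a n i j) * MvPolynomial.X 0 ^ i
      * MvPolynomial.X 1 ^ j : Poly)
      = MvPolynomial.monomial (Finsupp.single 0 i + Finsupp.single 1 j) (walks a n i j) := by
    intro i j
    rw [MvPolynomial.X_pow_eq_monomial, MvPolynomial.X_pow_eq_monomial, MvPolynomial.C_mul_monomial,
      MvPolynomial.monomial_mul, mul_one, mul_one]
  have hm : ∀ i j : ℕ, (Finsupp.single 0 i + Finsupp.single 1 j = m) ↔ i = m 0 ∧ j = m 1 := by
    intro i j
    constructor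
    · rintro rfl; simp
    · rintro ⟨rfl, rfl⟩
      ext k; fin_cases k <;> simp
  simp only [genFun, PowerSeries.coeff_mk, hmon, MvPolynomial.coeff_sum, MvPolynomial.coeff_monomial,
    hm]
  by_cases h0 : m 0 < n + 1
  · by_cases h1 : m 1 < n + 1
    · rw [Finset.sum_eq_single (m 0), Finset.sum_eq_single (m 1)]
      · simp
      · intro j _ hj; simp [hj]
      · intro h; exact absurd (Finset.mem_range.2 h1) h
      · intro i _ hi; simp [hi]
      · intro h; exact absurd (Finset.mem_range.2 h0) h
    · rw [walks_eq_zero _ _ _ _ (Or.inr (by omega))]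
      refine Finset.sum_eq_zero fun i _ => Finset.sum_eq_zero fun j hj => if_neg ?_
      rintro ⟨_, rfl⟩; exact h1 (Finset.mem_range.1 hj)
  · rw [walks_eq_zero _ _ _ _ (Or.inl (by omega))]
    refine Finset.sum_eq_zero fun i hi => Finset.sum_eq_zero fun j _ => if_neg ?_
    rintro ⟨rfl, _⟩; exact h0 (Finset.mem_range.1 hi)

/-- A power series in `t` over a commutative ring is D-finite if it satisfies a nontrivial
linear ordinary differential equation `∑_{k ≤ r} p_k(t) F^{(k)}(t) = 0` whose coefficients `p_k`
are polynomials in `t`. -/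
def DFinite {R : Type*} [CommRing R] (F : R⟦X⟧) : Prop :=
  ∃ (r : ℕ) (p : ℕ → Polynomial R), (∃ k ≤ r, p k ≠ 0) ∧
    ∑ k ∈ Finset.range (r + 1), (p k : R⟦X⟧) * (PowerSeries.derivative R)^[k] F = 0

/-! ### The group of a model -/

/-- The field `ℂ(x, y)`. -/
abbrev RatXY : Type := FractionRing Poly

/-- The element `x` of `ℂ(x, y)`. -/
noncomputable def x : RatXY := algebraMap Poly RatXY (MvPolynomial.X 0)

/-- The element `y` of `ℂ(x, y)`. -/
noncomputable def y : RatXY := algebraMap Poly RatXY (MvPolynomial.X 1)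

theorem x_ne_zero : x ≠ 0 := by
  simp [x]

theorem y_ne_zero : y ≠ 0 := by
  simp [y]

/-- If substituting `g` for the variables is an involution on the generators, then no nonzero
polynomial vanishes at `g`. -/
theorem aeval_injective (g : Fin 2 → RatXY) (P Q : Fin 2 → Poly)
    (hQ : ∀ i, Q i ≠ 0) (hgQ : ∀ i, MvPolynomial.aeval g (Q i) ≠ 0)
    (hg : ∀ i, g i * algebraMap Poly RatXY (Q i) = algebraMap Poly RatXY (P i))
    (hgg : ∀ i, MvPolynomial.aeval g (P i)
      = algebraMap Poly RatXY (MvPolynomial.X i) * MvPolynomial.aeval g (Q i)) :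
    Function.Injective (MvPolynomial.aeval g : Poly →ₐ[ℂ] RatXY) := by
  have key : ∀ p : Poly, ∃ P' Q' : Poly, Q' ≠ 0 ∧ MvPolynomial.aeval g Q' ≠ 0 ∧
      MvPolynomial.aeval g p * algebraMap Poly RatXY Q' = algebraMap Poly RatXY P' ∧
      MvPolynomial.aeval g P' = algebraMap Poly RatXY p * MvPolynomial.aeval g Q' := by
    intro p
    induction p using MvPolynomial.induction_on with
    | C c =>
      refine ⟨MvPolynomial.C c, 1, one_ne_zero, by simp, ?_, ?_⟩
      · rw [map_one, mul_one, ← MvPolynomial.algebraMap_eq, AlgHom.commutes,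
          ← IsScalarTower.algebraMap_apply]
      · rw [map_one, mul_one, ← MvPolynomial.algebraMap_eq, AlgHom.commutes,
          ← IsScalarTower.algebraMap_apply]
    | add p q hp hq =>
      obtain ⟨P₁, Q₁, h1, h2, h3, h4⟩ := hp
      obtain ⟨P₂, Q₂, k1, k2, k3, k4⟩ := hq
      refine ⟨P₁ * Q₂ + P₂ * Q₁, Q₁ * Q₂, mul_ne_zero h1 k1, ?_, ?_, ?_⟩
      · rw [map_mul]; exact mul_ne_zero h2 k2
      · simp only [map_add, map_mul, ← h3, ← k3]; ring
      · simp only [map_add, map_mul, h4, k4]; ring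
    | mul_X p i hp =>
      obtain ⟨P₁, Q₁, h1, h2, h3, h4⟩ := hp
      refine ⟨P₁ * P i, Q₁ * Q i, mul_ne_zero h1 (hQ i), ?_, ?_, ?_⟩
      · rw [map_mul]; exact mul_ne_zero h2 (hgQ i)
      · simp only [map_mul, ← h3, ← hg, MvPolynomial.aeval_X]; ring
      · simp only [map_mul, h4, hgg]; ring
  rw [injective_iff_map_eq_zero]
  intro p hp
  obtain ⟨P', Q', h1, h2, h3, h4⟩ := key p
  rw [hp, zero_mul] at h3
  have hP' : P' = 0 := (IsFractionRing.injective Poly RatXY) (by rw [← h3, map_zero])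
  rw [hP', map_zero] at h4
  have := (mul_eq_zero.mp h4.symm).resolve_right h2
  exact (IsFractionRing.injective Poly RatXY) (by rw [this, map_zero])

/-- `∑_v a_{1,v} y^v`, and so on: the Laurent polynomial with coefficients `c (-1), c 0, c 1`
at the point `z` of `ℂ(x, y)`. -/
noncomputable def side (c : ℤ → ℂ) (z : RatXY) : RatXY :=
  ∑ k ∈ Finset.Icc (-1 : ℤ) 1, algebraMap ℂ RatXY (c k) * z ^ k

/-- `z` times `side c z`, as a polynomial in the variable `z = X i`. -/
noncomputable def sidePoly (c : ℤ → ℂ) (i : Fin 2) : Poly :=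
  MvPolynomial.C (c (-1)) + MvPolynomial.C (c 0) * MvPolynomial.X i
    + MvPolynomial.C (c 1) * MvPolynomial.X i ^ 2

theorem side_mul (c : ℤ → ℂ) (i : Fin 2) :
    side c (algebraMap Poly RatXY (MvPolynomial.X i)) * algebraMap Poly RatXY (MvPolynomial.X i)
      = algebraMap Poly RatXY (sidePoly c i) := by
  have hz : algebraMap Poly RatXY (MvPolynomial.X i) ≠ 0 := by simp
  have hI : Finset.Icc (-1 : ℤ) 1 = {-1, 0, 1} := by decide
  have hC : ∀ z : ℂ, algebraMap Poly RatXY (MvPolynomial.C z) = algebraMap ℂ RatXY z := fun z => by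
    rw [← MvPolynomial.algebraMap_eq, ← IsScalarTower.algebraMap_apply]
  simp only [side, sidePoly, hI, map_add, map_mul, map_pow, hC]
  rw [Finset.sum_insert (by decide), Finset.sum_insert (by decide), Finset.sum_singleton]
  simp only [zpow_neg, zpow_one, zpow_zero]
  field_simp
  ring

theorem sidePoly_ne_zero (c : ℤ → ℂ) (i : Fin 2) (h : ¬ (c (-1) = 0 ∧ c 0 = 0 ∧ c 1 = 0)) :
    sidePoly c i ≠ 0 := by
  intro h0
  apply h
  have hp : (Polynomial.C (c (-1)) + Polynomial.C (c 0) * Polynomial.X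
      + Polynomial.C (c 1) * Polynomial.X ^ 2 : Polynomial ℂ) = 0 := by
    have := congrArg (MvPolynomial.aeval (fun _ : Fin 2 => (Polynomial.X : Polynomial ℂ))) h0
    simpa [sidePoly, Polynomial.C_eq_algebraMap, ← MvPolynomial.algebraMap_eq] using this
  refine ⟨?_, ?_, ?_⟩
  · simpa using congrArg (fun p => Polynomial.coeff p 0) hp
  · simpa [Polynomial.coeff_X, Polynomial.coeff_C] using congrArg (fun p => Polynomial.coeff p 1) hp
  · simpa [Polynomial.coeff_X, Polynomial.coeff_C] using congrArg (fun p => Polynomial.coeff p 2) hp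

theorem side_ne_zero (c : ℤ → ℂ) (i : Fin 2) (h : ¬ (c (-1) = 0 ∧ c 0 = 0 ∧ c 1 = 0)) :
    side c (algebraMap Poly RatXY (MvPolynomial.X i)) ≠ 0 := by
  intro h0
  have := side_mul c i
  rw [h0, zero_mul] at this
  exact sidePoly_ne_zero c i h ((IsFractionRing.injective Poly RatXY) (by rw [← this, map_zero]))

/-- The images of the variables under the substitution that replaces the variable `X i` by
`X i⁻¹ * side c z / side d z`, where `z` is the other variable, and that fixes `z`. -/
noncomputable def flipImage (i j : Fin 2) (c d : ℤ → ℂ) : Fin 2 → RatXY :=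
  fun k => if k = i then
    1 / algebraMap Poly RatXY (MvPolynomial.X i)
      * (side c (algebraMap Poly RatXY (MvPolynomial.X j))
        / side d (algebraMap Poly RatXY (MvPolynomial.X j)))
  else algebraMap Poly RatXY (MvPolynomial.X k)

theorem aeval_sidePoly (g : Fin 2 → RatXY) (c : ℤ → ℂ) (j : Fin 2)
    (hj : g j = algebraMap Poly RatXY (MvPolynomial.X j)) :
    MvPolynomial.aeval g (sidePoly c j) = algebraMap Poly RatXY (sidePoly c j) := by
  simp only [sidePoly, map_add, map_mul, map_pow, MvPolynomial.aeval_X, hj, MvPolynomial.aeval_C]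
  simp only [← MvPolynomial.algebraMap_eq, ← IsScalarTower.algebraMap_apply]

theorem flipImage_eq (i j : Fin 2) (c d : ℤ → ℂ) :
    flipImage i j c d i = 1 / algebraMap Poly RatXY (MvPolynomial.X i)
      * (algebraMap Poly RatXY (sidePoly c j) / algebraMap Poly RatXY (sidePoly d j)) := by
  have hz : algebraMap Poly RatXY (MvPolynomial.X j) ≠ 0 := by simp
  rw [flipImage, if_pos rfl, ← side_mul, ← side_mul, mul_div_mul_right _ _ hz]

theorem flipImage_injective (i j : Fin 2) (hij : j ≠ i) (c d : ℤ → ℂ)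
    (hc : ¬ (c (-1) = 0 ∧ c 0 = 0 ∧ c 1 = 0)) (hd : ¬ (d (-1) = 0 ∧ d 0 = 0 ∧ d 1 = 0)) :
    Function.Injective (MvPolynomial.aeval (flipImage i j c d) : Poly →ₐ[ℂ] RatXY) := by
  have hx : algebraMap Poly RatXY (MvPolynomial.X i) ≠ 0 := by simp
  have hc' : algebraMap Poly RatXY (sidePoly c j) ≠ 0 := by
    simpa using sidePoly_ne_zero c j hc
  have hd' : algebraMap Poly RatXY (sidePoly d j) ≠ 0 := by
    simpa using sidePoly_ne_zero d j hd
  have hj : flipImage i j c d j = algebraMap Poly RatXY (MvPolynomial.X j) := by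
    simp [flipImage, hij]
  have hoth : ∀ k, k ≠ i → flipImage i j c d k = algebraMap Poly RatXY (MvPolynomial.X k) := by
    intro k hk; simp [flipImage, hk]
  refine aeval_injective _ (fun k => if k = i then sidePoly c j else MvPolynomial.X k)
    (fun k => if k = i then MvPolynomial.X i * sidePoly d j else 1) ?_ ?_ ?_ ?_ <;> intro k <;>
    by_cases hk : k = i
  · simp [hk, sidePoly_ne_zero d j hd]
  · simp [hk]
  · subst hk
    simp only [if_true, map_mul, MvPolynomial.aeval_X, aeval_sidePoly _ _ _ hj, flipImage_eq]
    field_simp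
    simpa using sidePoly_ne_zero c j hc
  · simp [hk]
  · subst hk
    simp only [if_true, map_mul, flipImage_eq]
    field_simp
  · simp [hk, hoth]
  · subst hk
    simp only [if_true, map_mul, MvPolynomial.aeval_X, aeval_sidePoly _ _ _ hj, flipImage_eq]
    field_simp
  · simp [hk, hoth]

/-- The substitution `flipImage` as an endomorphism of the field `ℂ(x, y)`. -/
noncomputable def flipHom (i j : Fin 2) (hij : j ≠ i) (c d : ℤ → ℂ)
    (hc : ¬ (c (-1) = 0 ∧ c 0 = 0 ∧ c 1 = 0)) (hd : ¬ (d (-1) = 0 ∧ d 0 = 0 ∧ d 1 = 0)) :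
    RatXY →ₐ[ℂ] RatXY :=
  IsFractionRing.liftAlgHom (flipImage_injective i j hij c d hc hd)

theorem flipHom_X (i j : Fin 2) (hij : j ≠ i) (c d : ℤ → ℂ)
    (hc : ¬ (c (-1) = 0 ∧ c 0 = 0 ∧ c 1 = 0)) (hd : ¬ (d (-1) = 0 ∧ d 0 = 0 ∧ d 1 = 0))
    (k : Fin 2) :
    flipHom i j hij c d hc hd (algebraMap Poly RatXY (MvPolynomial.X k)) = flipImage i j c d k := by
  rw [flipHom, IsFractionRing.liftAlgHom_apply, IsFractionRing.lift_algebraMap]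
  exact MvPolynomial.aeval_X _ _

theorem flipHom_comp (i j : Fin 2) (hij : j ≠ i) (c d : ℤ → ℂ)
    (hc : ¬ (c (-1) = 0 ∧ c 0 = 0 ∧ c 1 = 0)) (hd : ¬ (d (-1) = 0 ∧ d 0 = 0 ∧ d 1 = 0)) :
    (flipHom i j hij c d hc hd).comp (flipHom i j hij c d hc hd) = AlgHom.id ℂ RatXY := by
  have hc' := side_ne_zero c j hc
  have hd' := side_ne_zero d j hd
  apply IsLocalization.algHom_ext (nonZeroDivisors Poly)
  apply MvPolynomial.algHom_ext
  intro k
  change flipHom i j hij c d hc hd (flipHom i j hij c d hc hd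
    (algebraMap Poly RatXY (MvPolynomial.X k))) = algebraMap Poly RatXY (MvPolynomial.X k)
  have hj : flipHom i j hij c d hc hd (algebraMap Poly RatXY (MvPolynomial.X j))
      = algebraMap Poly RatXY (MvPolynomial.X j) := by
    rw [flipHom_X]; simp [flipImage, hij]
  have hs : ∀ e : ℤ → ℂ, flipHom i j hij c d hc hd
      (side e (algebraMap Poly RatXY (MvPolynomial.X j)))
      = side e (algebraMap Poly RatXY (MvPolynomial.X j)) := by
    intro e
    simp only [side, map_sum, map_mul, map_zpow₀, hj, AlgHom.commutes]
  by_cases hk : k = i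
  · subst hk
    have hx : algebraMap Poly RatXY (MvPolynomial.X k) ≠ 0 := by simp
    have h1 : flipHom k j hij c d hc hd (algebraMap Poly RatXY (MvPolynomial.X k))
      = 1 / algebraMap Poly RatXY (MvPolynomial.X k)
      * (side c (algebraMap Poly RatXY (MvPolynomial.X j))
        / side d (algebraMap Poly RatXY (MvPolynomial.X j))) := by
      rw [flipHom_X]; simp [flipImage]
    rw [h1]
    simp only [map_mul, map_div₀, map_one, hs, h1]
    field_simp
  · have h1 : flipHom i j hij c d hc hd (algebraMap Poly RatXY (MvPolynomial.X k))
      = algebraMap Poly RatXY (MvPolynomial.X k) := by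
      rw [flipHom_X]; simp [flipImage, hk]
    rw [h1, h1]

/-- The substitution `flipImage` as an automorphism of the field `ℂ(x, y)`. -/
noncomputable def flipEquiv (i j : Fin 2) (hij : j ≠ i) (c d : ℤ → ℂ)
    (hc : ¬ (c (-1) = 0 ∧ c 0 = 0 ∧ c 1 = 0)) (hd : ¬ (d (-1) = 0 ∧ d 0 = 0 ∧ d 1 = 0)) :
    RatXY ≃ₐ[ℂ] RatXY :=
  AlgEquiv.ofAlgHom (flipHom i j hij c d hc hd) (flipHom i j hij c d hc hd)
    (flipHom_comp i j hij c d hc hd) (flipHom_comp i j hij c d hc hd)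

/-- The automorphism `Φ` of `ℂ(x, y)` over `ℂ` with
`Φ(x) = x⁻¹ (∑_v a_{-1,v} y^v) / (∑_v a_{1,v} y^v)` and `Φ(y) = y`. -/
noncomputable def Phi (a : Model) (ha : Interesting a) : RatXY ≃ₐ[ℂ] RatXY :=
  flipEquiv 0 1 (by decide) (fun v => a (-1) v) (fun v => a 1 v)
    (fun h => ha (Or.inr (Or.inr (Or.inl h)))) (fun h => ha (Or.inl h))

/-- The automorphism `Ψ` of `ℂ(x, y)` over `ℂ` with
`Ψ(x) = x` and `Ψ(y) = y⁻¹ (∑_u a_{u,-1} x^u) / (∑_u a_{u,1} x^u)`. -/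
noncomputable def Psi (a : Model) (ha : Interesting a) : RatXY ≃ₐ[ℂ] RatXY :=
  flipEquiv 1 0 (by decide) (fun u => a u (-1)) (fun u => a u 1)
    (fun h => ha (Or.inr (Or.inr (Or.inr h)))) (fun h => ha (Or.inr (Or.inl h)))

theorem Phi_x (a : Model) (ha : Interesting a) :
    Phi a ha x = 1 / x * ((∑ v ∈ Finset.Icc (-1 : ℤ) 1, algebraMap ℂ RatXY (a (-1) v) * y ^ v)
      / ∑ v ∈ Finset.Icc (-1 : ℤ) 1, algebraMap ℂ RatXY (a 1 v) * y ^ v) := by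
  exact (flipHom_X 0 1 (by decide) (fun v => a (-1) v) (fun v => a 1 v)
    (fun h => ha (Or.inr (Or.inr (Or.inl h)))) (fun h => ha (Or.inl h)) 0).trans (if_pos rfl)

theorem Phi_y (a : Model) (ha : Interesting a) : Phi a ha y = y := by
  exact (flipHom_X 0 1 (by decide) (fun v => a (-1) v) (fun v => a 1 v)
    (fun h => ha (Or.inr (Or.inr (Or.inl h)))) (fun h => ha (Or.inl h)) 1).trans (if_neg (by decide))

theorem Psi_x (a : Model) (ha : Interesting a) : Psi a ha x = x := by
  exact (flipHom_X 1 0 (by decide) (fun u => a u (-1)) (fun u => a u 1)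
    (fun h => ha (Or.inr (Or.inr (Or.inr h)))) (fun h => ha (Or.inr (Or.inl h))) 0).trans (if_neg (by decide))

theorem Psi_y (a : Model) (ha : Interesting a) :
    Psi a ha y = 1 / y * ((∑ u ∈ Finset.Icc (-1 : ℤ) 1, algebraMap ℂ RatXY (a u (-1)) * x ^ u)
      / ∑ u ∈ Finset.Icc (-1 : ℤ) 1, algebraMap ℂ RatXY (a u 1) * x ^ u) := by
  exact (flipHom_X 1 0 (by decide) (fun u => a u (-1)) (fun u => a u 1)
    (fun h => ha (Or.inr (Or.inr (Or.inr h)))) (fun h => ha (Or.inr (Or.inl h))) 1).trans (if_pos rfl)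

/-- The group of the model, generated by `Φ` and `Ψ` under composition. -/
noncomputable def modelGroup (a : Model) (ha : Interesting a) : Subgroup (RatXY ≃ₐ[ℂ] RatXY) :=
  Subgroup.closure {Phi a ha, Psi a ha}

/-- `a_{-1,v} = l a_{1,v}` for `v = -1, 0, 1`. -/
def Proportional (a : Model) (l : ℂ) : Prop :=
  ∀ v ∈ Finset.Icc (-1 : ℤ) 1, a (-1) v = l * a 1 v

/-! ### Positive parts and the orbit sum

`RatFunc ℂ` is the field `ℂ(x)`; the ring `ℂ(x)[y, y⁻¹][[t]]` contains the expansion in powers of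
`t` of each rational function in `x, y, t` whose denominator is a polynomial in `x`, times
a power of `y`, times a power of the kernel `K`. -/

/-- The positive part of a Laurent polynomial: all terms with a positive exponent are kept. -/
noncomputable def positivePart {R : Type*} [Semiring R] (p : R[T;T⁻¹]) : R[T;T⁻¹] :=
  AddMonoidAlgebra.ofCoeff (p.coeff.filter (fun k : ℤ => 0 < k))

/-- The operator `[y^>]` on `R[y, y⁻¹][[t]]`. -/
noncomputable def yPositive {R : Type*} [Semiring R] (F : R[T;T⁻¹]⟦X⟧) : R[T;T⁻¹]⟦X⟧ :=
  PowerSeries.mk fun n => positivePart (PowerSeries.coeff n F)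

/-- The operator `[x^>]` on `ℂ[x, x⁻¹][y, y⁻¹][[t]]`. -/
noncomputable def xPositive (F : ℂ[T;T⁻¹][T;T⁻¹]⟦X⟧) : ℂ[T;T⁻¹][T;T⁻¹]⟦X⟧ :=
  PowerSeries.mk fun n => AddMonoidAlgebra.ofCoeff
    ((PowerSeries.coeff n F).coeff.mapRange positivePart (by ext; simp [positivePart, Finsupp.filter_apply]))

/-- The inclusion `ℂ[x, x⁻¹] → ℂ(x)`. -/
noncomputable def laurentToRatFunc : ℂ[T;T⁻¹] →+* RatFunc ℂ :=
  LaurentPolynomial.eval₂ (algebraMap ℂ (RatFunc ℂ)) (Units.mk0 RatFunc.X RatFunc.X_ne_zero)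

/-- The inclusion `ℂ[x, x⁻¹][y, y⁻¹][[t]] → ℂ(x)[y, y⁻¹][[t]]`. -/
noncomputable def laurentInclusion : ℂ[T;T⁻¹][T;T⁻¹]⟦X⟧ →+* (RatFunc ℂ)[T;T⁻¹]⟦X⟧ :=
  PowerSeries.map (LaurentPolynomial.eval₂ (LaurentPolynomial.C.comp laurentToRatFunc)
    ⟨LaurentPolynomial.T 1, LaurentPolynomial.T (-1),
      by rw [← LaurentPolynomial.T_add]; simp, by rw [← LaurentPolynomial.T_add]; simp⟩)

/-- The inclusion `ℂ[x, y][[t]] → ℂ[x, x⁻¹][y, y⁻¹][[t]]`. -/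
noncomputable def polyInclusion : Poly⟦X⟧ →+* ℂ[T;T⁻¹][T;T⁻¹]⟦X⟧ :=
  PowerSeries.map (MvPolynomial.eval₂Hom (LaurentPolynomial.C.comp LaurentPolynomial.C)
    ![LaurentPolynomial.C (LaurentPolynomial.T 1), LaurentPolynomial.T 1])

/-- The kernel `K(x, y, t) = 1 - t ∑_{u,v} a_{u,v} x^u y^v` in `ℂ(x)[y, y⁻¹][[t]]`. -/
noncomputable def kernel (a : Model) : (RatFunc ℂ)[T;T⁻¹]⟦X⟧ :=
  1 - PowerSeries.X * PowerSeries.C (∑ d ∈ directions,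
    LaurentPolynomial.C (algebraMap ℂ (RatFunc ℂ) (a d.1 d.2) * RatFunc.X ^ d.1)
      * LaurentPolynomial.T d.2)

/-- The inverse `1 / K` of the kernel in `ℂ(x)[y, y⁻¹][[t]]`. -/
noncomputable def kernelInv (a : Model) : (RatFunc ℂ)[T;T⁻¹]⟦X⟧ :=
  PowerSeries.invOfUnit (kernel a) 1

theorem kernel_mul_kernelInv (a : Model) : kernel a * kernelInv a = 1 :=
  PowerSeries.mul_invOfUnit _ _ (by simp [kernel])

/-- The rational function
`(x² - l) (a_{0,1} x y² - a_{0,-1} x - (l + x²) (a_{1,-1} - a_{1,1} y²))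
  / (x y (a_{1,1} (l + x²) + a_{0,1} x) K(x, y, t))`
as an element of `ℂ(x)[y, y⁻¹][[t]]`. -/
noncomputable def orbitSum (a : Model) (l : ℂ) : (RatFunc ℂ)[T;T⁻¹]⟦X⟧ :=
  let c : ℂ → RatFunc ℂ := algebraMap ℂ (RatFunc ℂ)
  let X : RatFunc ℂ := RatFunc.X
  let C : RatFunc ℂ →+* (RatFunc ℂ)[T;T⁻¹] := LaurentPolynomial.C
  let y : ℤ → (RatFunc ℂ)[T;T⁻¹] := LaurentPolynomial.T
  PowerSeries.C
    (C ((X ^ 2 - c l) / (X * (c (a 1 1) * (c l + X ^ 2) + c (a 0 1) * X))) * y (-1)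
      * (C (c (a 0 1) * X) * y 2 - C (c (a 0 (-1)) * X)
        - C (c l + X ^ 2) * (C (c (a 1 (-1))) - C (c (a 1 1)) * y 2)))
    * kernelInv a

/-- `f = (x y)⁻¹ [x^>] [y^>] R`, where `R ∈ ℂ(x)[y, y⁻¹][[t]]`: the series `[y^>] R` has
its coefficients in `ℂ[x, x⁻¹]` (say that it is the image of `G`), and `f = (x y)⁻¹ [x^>] G`. -/
def IsPositivePart (f : Poly⟦X⟧) (R : (RatFunc ℂ)[T;T⁻¹]⟦X⟧) : Prop :=
  ∃ G : ℂ[T;T⁻¹][T;T⁻¹]⟦X⟧, laurentInclusion G = yPositive R ∧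
    polyInclusion f = PowerSeries.C (LaurentPolynomial.C (LaurentPolynomial.T (-1))
      * LaurentPolynomial.T (-1)) * xPositive G

end QuarterPlane

/-! Group. `Phi` and `Psi` are distinct involutions, so they generate the four-element dihedral
group exactly when they commute. Write p, q for the sides v = -1, 1 as polynomials in x, and r, s
for the sides u = -1, 1 as polynomials in y. Commutation, tested on y, says that p/q is unchanged
under x ↦ x' = r(y)/(s(y) x). Clearing denominators and dividing by x' - x leaves a relation that is
linear in x + x' and x x', with the 2×2 minors of (p, q) as coefficients. Comparing powers of x,
either all minors vanish, so p and q are proportional, or r and s are (`proportional_of_commute`).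
The converse is `commute_of_proportional`.

Orbit sum. If a_{-1,v} = l a_{1,v}, the step polynomial S is invariant under x ↦ l/x and under y ↦
p/(q y). The defect in the recurrence for the coefficients of x y f is supported on the two axes.
Antisymmetrizing in x leaves a defect free of y (`flipX_boundary`), and antisymmetrizing in y then
removes it (`fullOrbit_succ`). Hence the full orbit sum is its initial value times the sum of S^n
t^n, which is 1/K. The reflected copies have only nonpositive exponents of y or of x, so x y f is
recovered by taking positive parts (`isPositivePart_orbitSum`).

D-finiteness. Taking the positive part, dividing by x y and evaluating at (x, y) is the same as
taking the double residue in new variables u, v, expanded at infinity, against 1/(u v (u - x)(v -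
y)) (`residue_orbitSum`). So f is a double residue of a rational function F of t, u, v over the
field ℂ(x, y). A dimension count gives a linear relation between t^a ∂t^b ∂u^i ∂v^j F whose
coefficients do not involve u and v (`exists_relation_derivations`). Multiplying by a suitable u^m
v^l and taking residues integrates ∂u and ∂v away and leaves a nontrivial equation in t
(`exists_relation_residue`). Clearing denominators moves it to ℂ[x, y] (`dFinite_of_relation`). The
reflected case follows by exchanging x and y. -/

namespace QuarterPlane

/-! ### Residues of rational functions are D-finite -/

section Telescoping

variable {k M : Type*} [Field k] [CommRing M] [Algebra k M]

/-- The span of the monomials in `t, u, v` with all exponents at most `D`. -/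
def boxSpan (k : Type*) {M : Type*} [Field k] [CommRing M] [Algebra k M] (t u v : M) (D : ℕ) :
    Submodule k M :=
  Submodule.span k (Set.range fun e : Fin (D + 1) × Fin (D + 1) × Fin (D + 1) =>
    t ^ (e.1 : ℕ) * u ^ (e.2.1 : ℕ) * v ^ (e.2.2 : ℕ))

theorem monomial_mem_boxSpan (t u v : M) {D i j l : ℕ} (hi : i ≤ D) (hj : j ≤ D) (hl : l ≤ D) :
    t ^ i * u ^ j * v ^ l ∈ boxSpan k t u v D :=
  Submodule.subset_span ⟨(⟨i, by omega⟩, ⟨j, by omega⟩, ⟨l, by omega⟩), rfl⟩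

theorem boxSpan_induction (t u v : M) {D : ℕ} {p : M → Prop} {z : M} (hz : z ∈ boxSpan k t u v D)
    (mon : ∀ i j l : ℕ, i ≤ D → j ≤ D → l ≤ D → p (t ^ i * u ^ j * v ^ l)) (zero : p 0)
    (add : ∀ a b, p a → p b → p (a + b)) (smul : ∀ (c : k) a, p a → p (c • a)) : p z := by
  refine Submodule.span_induction ?_ zero (fun a b _ _ => add a b) (fun c a _ => smul c a) hz
  rintro _ ⟨e, rfl⟩
  exact mon _ _ _ (by omega) (by omega) (by omega)

instance (t u v : M) (D : ℕ) : FiniteDimensional k (boxSpan k t u v D) :=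
  FiniteDimensional.span_of_finite k (Set.finite_range _)

theorem finrank_boxSpan_le (t u v : M) (D : ℕ) :
    Module.finrank k (boxSpan k t u v D) ≤ (D + 1) ^ 3 := by
  refine (finrank_range_le_card _).trans ?_
  simp only [Fintype.card_prod, Fintype.card_fin]
  exact le_of_eq (by ring)

theorem boxSpan_mono (t u v : M) {D D' : ℕ} (h : D ≤ D') :
    boxSpan k t u v D ≤ boxSpan k t u v D' := fun _ hz =>
  boxSpan_induction t u v hz
    (fun _ _ _ hi hj hl => monomial_mem_boxSpan t u v (hi.trans h) (hj.trans h) (hl.trans h))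
    (zero_mem _) (fun _ _ => add_mem) (fun c _ => Submodule.smul_mem _ c)

theorem mul_mem_boxSpan (t u v : M) {D D' : ℕ} {p q : M} (hp : p ∈ boxSpan k t u v D)
    (hq : q ∈ boxSpan k t u v D') : p * q ∈ boxSpan k t u v (D + D') := by
  refine boxSpan_induction (p := fun z => z * q ∈ boxSpan k t u v (D + D')) t u v hp
    (fun i j l hi hj hl => ?_) (by simp)
    (fun a b ha hb => by rw [add_mul]; exact add_mem ha hb)
    (fun c a ha => by rw [smul_mul_assoc]; exact Submodule.smul_mem _ c ha)
  refine boxSpan_induction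
    (p := fun z => t ^ i * u ^ j * v ^ l * z ∈ boxSpan k t u v (D + D')) t u v hq
    (fun i' j' l' hi' hj' hl' => ?_) (by simp)
    (fun a b ha hb => by rw [mul_add]; exact add_mem ha hb)
    (fun c a ha => by rw [mul_smul_comm]; exact Submodule.smul_mem _ c ha)
  have := monomial_mem_boxSpan (k := k) t u v (add_le_add hi hi') (add_le_add hj hj')
    (add_le_add hl hl')
  convert this using 1
  ring

theorem one_mem_boxSpan (t u v : M) (D : ℕ) : (1 : M) ∈ boxSpan k t u v D := by
  simpa using monomial_mem_boxSpan (k := k) t u v D.zero_le D.zero_le D.zero_le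

theorem pow_mem_boxSpan (t u v : M) {D : ℕ} {p : M} (hp : p ∈ boxSpan k t u v D) (n : ℕ) :
    p ^ n ∈ boxSpan k t u v (n * D) := by
  induction n with
  | zero => simpa using one_mem_boxSpan t u v _
  | succ n ih =>
    rw [pow_succ, Nat.succ_mul]
    exact mul_mem_boxSpan t u v ih hp

theorem exists_mem_boxSpan (t u v : M) {p : M} (hp : p ∈ Algebra.adjoin k {t, u, v}) :
    ∃ D, p ∈ boxSpan k t u v D := by
  induction hp using Algebra.adjoin_induction with
  | mem z hz =>
    refine ⟨1, ?_⟩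
    rcases hz with rfl | rfl | rfl
    · simpa using monomial_mem_boxSpan (k := k) z u v le_rfl zero_le_one zero_le_one
    · simpa using monomial_mem_boxSpan (k := k) t z v zero_le_one le_rfl zero_le_one
    · simpa using monomial_mem_boxSpan (k := k) t u z zero_le_one zero_le_one le_rfl
  | algebraMap r =>
    refine ⟨0, ?_⟩
    rw [Algebra.algebraMap_eq_smul_one]
    exact Submodule.smul_mem _ _ (one_mem_boxSpan t u v 0)
  | add a b _ _ ha hb =>
    obtain ⟨D, hD⟩ := ha
    obtain ⟨D', hD'⟩ := hb
    exact ⟨D + D', add_mem (boxSpan_mono t u v (by omega) hD) (boxSpan_mono t u v (by omega) hD')⟩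
  | mul a b _ _ ha hb =>
    obtain ⟨D, hD⟩ := ha
    obtain ⟨D', hD'⟩ := hb
    exact ⟨D + D', mul_mem_boxSpan t u v hD hD'⟩

/-- A derivation takes constant values on the three variables. -/
def ConstantOn (d : Derivation k M M) (t u v : M) : Prop :=
  ∀ z ∈ ({t, u, v} : Set M), ∃ c : k, d z = algebraMap k M c

theorem derivation_mem_boxSpan {t u v : M} {d : Derivation k M M} (hd : ConstantOn d t u v) {D : ℕ}
    {p : M} (hp : p ∈ boxSpan k t u v D) : d p ∈ boxSpan k t u v D := by
  obtain ⟨ct, ht⟩ := hd t (by simp)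
  obtain ⟨cu, hu⟩ := hd u (by simp)
  obtain ⟨cv, hv⟩ := hd v (by simp)
  refine boxSpan_induction (p := fun z => d z ∈ boxSpan k t u v D) t u v hp
    (fun i j l hi hj hl => ?_) (by simp)
    (fun a b ha hb => by rw [map_add]; exact add_mem ha hb)
    (fun c a ha => by rw [Derivation.map_smul]; exact Submodule.smul_mem _ c ha)
  -- The truncated exponents `i - 1`, `j - 1`, `l - 1` do no harm at zero, since their coefficients
  -- vanish there.
  have key : d (t ^ i * u ^ j * v ^ l) = (i * ct : k) • (t ^ (i - 1) * u ^ j * v ^ l)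
      + (j * cu : k) • (t ^ i * u ^ (j - 1) * v ^ l)
      + (l * cv : k) • (t ^ i * u ^ j * v ^ (l - 1)) := by
    simp only [Derivation.leibniz, Derivation.leibniz_pow, ht, hu, hv, smul_eq_mul, nsmul_eq_mul]
    simp only [Algebra.smul_def, map_mul, map_natCast]
    ring
  rw [key]
  refine add_mem (add_mem ?_ ?_) ?_ <;> refine Submodule.smul_mem _ _ ?_
  · exact monomial_mem_boxSpan t u v (by omega) hj hl
  · exact monomial_mem_boxSpan t u v hi (by omega) hl
  · exact monomial_mem_boxSpan t u v hi hj (by omega)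

/-- This is the quotient rule: each derivative costs one more factor `q` in the denominator and
raises the degree of the numerator by at most `e`. This linear growth makes the dimension count
work. -/
theorem derivation_iterate_mem_boxSpan {t u v : M} {d : Derivation k M M}
    (hd : ConstantOn d t u v) {e D s : ℕ} {q G : M} (hq : q ∈ boxSpan k t u v e)
    (hG : q ^ s * G ∈ boxSpan k t u v D) (n : ℕ) :
    q ^ (s + n) * d^[n] G ∈ boxSpan k t u v (D + n * e) := by
  induction n with
  | zero => simpa using hG
  | succ n ih =>
    rw [Function.iterate_succ_apply']
    set H := d^[n] G
    have key : q ^ (s + (n + 1)) * d H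
        = d (q ^ (s + n) * H) * q - ((s + n : ℕ) : k) • ((q ^ (s + n) * H) * d q) := by
      rw [Algebra.smul_def, map_natCast, Derivation.leibniz, Derivation.leibniz_pow]
      simp only [smul_eq_mul, nsmul_eq_mul]
      rcases Nat.eq_zero_or_pos (s + n) with h | h
      · rw [h, ← add_assoc, h]; simp; ring
      · obtain ⟨m, hm⟩ := Nat.exists_eq_add_of_lt h
        rw [← add_assoc, hm]
        simp only [zero_add, Nat.add_sub_cancel]
        ring
    rw [key, show D + (n + 1) * e = D + n * e + e by ring]
    exact sub_mem (mul_mem_boxSpan t u v (derivation_mem_boxSpan hd ih) hq)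
      (Submodule.smul_mem _ _ (mul_mem_boxSpan t u v ih (derivation_mem_boxSpan hd hq)))

/-- A quotient of polynomials in three variables satisfies a linear differential equation
whose coefficients involve only one of the variables. -/
theorem exists_relation_derivations [IsDomain M] {t u v : M} {dt du dv : Derivation k M M}
    (ht : ConstantOn dt t u v) (hu : ConstantOn du t u v) (hv : ConstantOn dv t u v)
    {F p q : M} (hq : q ≠ 0) (hF : q * F = p)
    (hpm : p ∈ Algebra.adjoin k {t, u, v}) (hqm : q ∈ Algebra.adjoin k {t, u, v}) :
    ∃ (n : ℕ) (c : Fin n × Fin n × Fin n × Fin n → k), (∃ i, c i ≠ 0) ∧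
      ∑ i, c i • (t ^ (i.1 : ℕ) * dt^[i.2.1] (du^[i.2.2.1] (dv^[i.2.2.2] F))) = 0 := by
  obtain ⟨d₁, hp⟩ := exists_mem_boxSpan t u v hpm
  obtain ⟨d₂, hq'⟩ := exists_mem_boxSpan t u v hqm
  set d := d₁ + d₂
  replace hp : p ∈ boxSpan k t u v d := boxSpan_mono t u v (by omega) hp
  replace hq' : q ∈ boxSpan k t u v d := boxSpan_mono t u v (by omega) hq'
  -- There will be `n ^ 4` products in a space of dimension at most `(D + 1) ^ 3 ≤ (4 * d + 2) ^ 3 *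
  -- n ^ 3`, so `n` only has to exceed `(4 * d + 2) ^ 3`. In `D`, the numerator `p` accounts for
  -- `d`, the at most `3 * n` further factors `q` for `d` each, and the power of `t` for `n`.
  set n := (4 * d + 2) ^ 3 + 1 with hn
  set D := d * (3 * n + 1) + n with hD
  have hmem : ∀ i : Fin n × Fin n × Fin n × Fin n,
      q ^ (3 * n + 1) * (t ^ (i.1 : ℕ) * dt^[i.2.1] (du^[i.2.2.1] (dv^[i.2.2.2] F)))
        ∈ boxSpan k t u v D := by
    rintro ⟨⟨a, ha⟩, ⟨b, hb⟩, ⟨c, hc⟩, ⟨e, he⟩⟩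
    have h0 : q ^ 1 * F ∈ boxSpan k t u v d := by rw [pow_one, hF]; exact hp
    have h1 := derivation_iterate_mem_boxSpan ht hq' (derivation_iterate_mem_boxSpan hu hq'
      (derivation_iterate_mem_boxSpan hv hq' h0 e) c) b
    have h2 : t ^ a ∈ boxSpan k t u v n := by
      simpa using monomial_mem_boxSpan (k := k) t u v ha.le n.zero_le n.zero_le
    have h3 := mul_mem_boxSpan t u v (mul_mem_boxSpan t u v h1 h2)
      (pow_mem_boxSpan t u v hq' (3 * n - (b + c + e)))
    obtain ⟨r, hr⟩ : ∃ r, 3 * n = b + c + e + r := Nat.exists_eq_add_of_le (by omega)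
    have hr' : 3 * n - (b + c + e) = r := by omega
    rw [hr'] at h3
    have hle : d + e * d + c * d + b * d + n + r * d ≤ D := by
      rw [hD, hr]; exact le_of_eq (by ring)
    refine boxSpan_mono t u v hle ?_
    convert h3 using 1
    rw [hr]
    ring
  have hcard : ¬ LinearIndependent k (fun i => (⟨_, hmem i⟩ : boxSpan k t u v D)) := by
    intro h
    have h1 := h.fintype_card_le_finrank.trans (finrank_boxSpan_le t u v D)
    simp only [Fintype.card_prod, Fintype.card_fin] at h1
    have h2 : D + 1 ≤ (4 * d + 2) * n := by
      rw [hD]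
      have : 1 ≤ n := by omega
      nlinarith
    have h3 : (D + 1) ^ 3 ≤ (4 * d + 2) ^ 3 * n ^ 3 := by
      rw [← mul_pow]; exact Nat.pow_le_pow_left h2 3
    have h4 : (4 * d + 2) ^ 3 * n ^ 3 < n * n ^ 3 :=
      Nat.mul_lt_mul_of_pos_right (by omega) (pow_pos (by omega) 3)
    have h5 : n * n ^ 3 = n * (n * (n * n)) := by ring
    omega
  obtain ⟨c, hc, i, hi⟩ := Fintype.not_linearIndependent_iff.1 hcard
  refine ⟨n, c, ⟨i, hi⟩, ?_⟩
  have := congrArg Subtype.val hc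
  simp only [AddSubmonoidClass.coe_finsetSum, SetLike.val_smul, ZeroMemClass.coe_zero] at this
  refine (mul_eq_zero.1 ?_).resolve_left (pow_ne_zero (3 * n + 1) hq)
  rw [Finset.mul_sum, ← this]
  exact Finset.sum_congr rfl fun i _ => mul_smul_comm _ _ _

theorem derivation_iterate_const_mul {d : Derivation k M M} {w : M} (hw : d w = 0) (n : ℕ) (G : M) :
    d^[n] (w * G) = w * d^[n] G := by
  induction n with
  | zero => rfl
  | succ n ih =>
    rw [Function.iterate_succ_apply', ih, Derivation.leibniz, hw, smul_zero, add_zero, smul_eq_mul,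
      ← Function.iterate_succ_apply' (f := d)]

/-! ### Integration by parts under a residue. -/

section Residue

variable {N : Type*} [AddCommGroup N] [Module k N] {ρ : M →ₗ[k] N} {d : Derivation k M M} {u : M}

/-- Integration by parts: the residue of `d (u ^ m * G)` is zero. -/
theorem residue_pow_mul_derivation (hρ : ∀ G, ρ (d G) = 0) (hu : d u = 1) (m : ℕ) (G : M) :
    ρ (u ^ m * d G) = -(m : k) • ρ (u ^ (m - 1) * G) := by
  have h := hρ (u ^ m * G)
  rw [Derivation.leibniz, Derivation.leibniz_pow, hu] at h
  have h' : G • m • u ^ (m - 1) • (1 : M) = (m : k) • (u ^ (m - 1) * G) := by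
    rw [Algebra.smul_def (m : k), map_natCast]; simp; ring
  rw [h', smul_eq_mul, map_add, map_smul] at h
  rw [neg_smul]
  exact eq_neg_of_add_eq_zero_left h

/-- Each integration by parts lowers the power of `u` and the order of the derivative by one; the
power of `u` is exhausted first, and a residue of a derivative remains. -/
theorem residue_pow_mul_iterate_of_lt (hρ : ∀ G, ρ (d G) = 0) (hu : d u = 1) {m n : ℕ}
    (h : m < n) (G : M) : ρ (u ^ m * d^[n] G) = 0 := by
  induction m generalizing n with
  | zero =>
    obtain ⟨n, rfl⟩ := Nat.exists_eq_succ_of_ne_zero (by omega : n ≠ 0)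
    rw [pow_zero, one_mul, Function.iterate_succ_apply', hρ]
  | succ m ih =>
    obtain ⟨n, rfl⟩ := Nat.exists_eq_succ_of_ne_zero (by omega : n ≠ 0)
    rw [Function.iterate_succ_apply', residue_pow_mul_derivation hρ hu, Nat.add_sub_cancel,
      ih (by omega), smul_zero]

/-- The constant is `(-1) ^ m * m!`, nonzero in characteristic zero. -/
theorem residue_pow_mul_iterate_self [CharZero k] (hρ : ∀ G, ρ (d G) = 0) (hu : d u = 1) (m : ℕ) :
    ∃ e : k, e ≠ 0 ∧ ∀ G, ρ (u ^ m * d^[m] G) = e • ρ G := by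
  induction m with
  | zero => exact ⟨1, one_ne_zero, fun G => by simp⟩
  | succ m ih =>
    obtain ⟨e, he, h⟩ := ih
    refine ⟨-((m + 1 : ℕ) : k) * e, mul_ne_zero (neg_ne_zero.2
      (by exact_mod_cast m.succ_ne_zero)) he,
      fun G => ?_⟩
    rw [Function.iterate_succ_apply', residue_pow_mul_derivation hρ hu, Nat.add_sub_cancel, h,
      smul_smul]

end Residue

/-- The residue in `u` and `v` of a quotient of polynomials in `t, u, v` is D-finite in `t`. -/
theorem exists_relation_residue [IsDomain M] [CharZero k] {t u v : M}
    {dt du dv : Derivation k M M}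
    (htt : dt t = 1) (htu : dt u = 0) (htv : dt v = 0) (hut : du t = 0) (huu : du u = 1)
    (huv : du v = 0) (hvt : dv t = 0) (hvu : dv u = 0) (hvv : dv v = 1)
    {ρ : M →ₗ[k] k⟦X⟧} (hρu : ∀ G, ρ (du G) = 0) (hρv : ∀ G, ρ (dv G) = 0)
    (hρt : ∀ G, ρ (t * G) = PowerSeries.X * ρ G)
    (hρd : ∀ G, ρ (dt G) = PowerSeries.derivative k (ρ G))
    {F p q : M} (hq : q ≠ 0) (hF : q * F = p)
    (hpm : p ∈ Algebra.adjoin k {t, u, v}) (hqm : q ∈ Algebra.adjoin k {t, u, v}) :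
    ∃ (n : ℕ) (c : Fin n → Fin n → k), (∃ a b, c a b ≠ 0) ∧
      ∑ a, ∑ b, c a b • (PowerSeries.X ^ (a : ℕ) * (PowerSeries.derivative k)^[b] (ρ F)) = 0 := by
  have h1 : ∀ (d : Derivation k M M) (z : M), d z = 0 → ∃ c : k, d z = algebraMap k M c :=
    fun d z h => ⟨0, by rw [h, map_zero]⟩
  have h2 : ∀ (d : Derivation k M M) (z : M), d z = 1 → ∃ c : k, d z = algebraMap k M c :=
    fun d z h => ⟨1, by rw [h, map_one]⟩
  obtain ⟨n, c, ⟨i₀, hi₀⟩, hc⟩ := exists_relation_derivations (dt := dt) (du := du) (dv := dv)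
    (t := t) (u := u) (v := v)
    (by rintro z (rfl | rfl | rfl); exacts [h2 _ _ htt, h1 _ _ htu, h1 _ _ htv])
    (by rintro z (rfl | rfl | rfl); exacts [h1 _ _ hut, h2 _ _ huu, h1 _ _ huv])
    (by rintro z (rfl | rfl | rfl); exacts [h1 _ _ hvt, h1 _ _ hvu, h2 _ _ hvv])
    hq hF hpm hqm
  classical
  -- Both exponents are less than `n`, so this weight orders the pairs of orders in `du` and `dv`
  -- lexicographically. After multiplication by `u ^ m * v ^ l` with `(m, l)` the least pair that
  -- occurs, every larger pair has residue zero and every smaller one has coefficient zero.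
  obtain ⟨⟨a₀, b₀, m, l⟩, hm, hmin⟩ := Finset.exists_min_image
    (Finset.univ.filter fun i => c i ≠ 0) (fun i => n * (i.2.2.1 : ℕ) + i.2.2.2)
    ⟨i₀, by simpa using hi₀⟩
  simp only [Finset.mem_filter, Finset.mem_univ, true_and, Prod.forall] at hm hmin
  obtain ⟨e, he, hue⟩ := residue_pow_mul_iterate_self hρu huu (m : ℕ)
  obtain ⟨e', he', hve⟩ := residue_pow_mul_iterate_self hρv hvv (l : ℕ)
  refine ⟨n, fun a b => c (a, b, m, l), ⟨a₀, b₀, hm⟩, ?_⟩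
  have htw : dt (u ^ (m : ℕ) * v ^ (l : ℕ)) = 0 := by
    simp [Derivation.leibniz, Derivation.leibniz_pow, htu, htv]
  have huw : du (v ^ (l : ℕ)) = 0 := by simp [Derivation.leibniz_pow, huv]
  have hiter : ∀ b G, ρ (dt^[b] G) = (PowerSeries.derivative k)^[b] (ρ G) := by
    intro b G
    induction b with
    | zero => rfl
    | succ b ih => rw [Function.iterate_succ_apply', Function.iterate_succ_apply', hρd, ih]
  have hpow : ∀ a G, ρ (t ^ a * G) = PowerSeries.X ^ a * ρ G := by
    intro a G
    induction a with
    | zero => simp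
    | succ a ih => rw [pow_succ', mul_assoc, hρt, ih, pow_succ', mul_assoc]
  -- The multiplier is constant for `dt`, and its factor in `v` is constant for `du`, so each moves
  -- inside the corresponding derivatives.
  have hterm : ∀ (a b i j : ℕ), ρ (u ^ (m : ℕ) * v ^ (l : ℕ)
      * (t ^ a * dt^[b] (du^[i] (dv^[j] F)))) = PowerSeries.X ^ a
        * (PowerSeries.derivative k)^[b] (ρ (u ^ (m : ℕ) * du^[i] (v ^ (l : ℕ) * dv^[j] F))) := by
    intro a b i j
    rw [mul_left_comm, hpow, ← derivation_iterate_const_mul htw, hiter, mul_assoc,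
      derivation_iterate_const_mul huw]
  have hz : ∀ i j : Fin n, (i, j) ≠ (m, l) → ∀ a b, c (a, b, i, j) ≠ 0 →
      ρ (u ^ (m : ℕ) * du^[i] (v ^ (l : ℕ) * dv^[j] F)) = 0 := by
    intro i j hij a b hne
    have hle := hmin a b i j hne
    rcases lt_trichotomy (m : ℕ) i with h | h | h
    · exact residue_pow_mul_iterate_of_lt hρu huu h _
    · rw [← h] at hle
      rw [← h, hue, residue_pow_mul_iterate_of_lt hρv hvv, smul_zero]
      refine lt_of_le_of_ne (by omega) fun h' => hij ?_
      rw [Fin.ext h, Fin.ext h']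
    · have h1 : n * (i : ℕ) + n ≤ n * m := by
        rw [← Nat.mul_succ]; exact Nat.mul_le_mul_left n h
      omega
  have key := congrArg (fun G => ρ (u ^ (m : ℕ) * v ^ (l : ℕ) * G)) hc
  simp only [Finset.mul_sum, mul_smul_comm, mul_zero, map_zero, map_sum, map_smul, hterm] at key
  simp only [Fintype.sum_prod_type] at key
  have hin : ∀ a b : Fin n, ∑ i, ∑ j, c (a, b, i, j) • (PowerSeries.X ^ (a : ℕ)
      * (PowerSeries.derivative k)^[b] (ρ (u ^ (m : ℕ) * du^[i] (v ^ (l : ℕ) * dv^[j] F))))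
      = (e * e') • c (a, b, m, l) • (PowerSeries.X ^ (a : ℕ)
        * (PowerSeries.derivative k)^[b] (ρ F)) := by
    intro a b
    have hzero : ∀ i j, (i, j) ≠ (m, l) → c (a, b, i, j) • (PowerSeries.X ^ (a : ℕ)
        * (PowerSeries.derivative k)^[b] (ρ (u ^ (m : ℕ) * du^[i] (v ^ (l : ℕ) * dv^[j] F))))
          = 0 := by
      intro i j hij
      by_cases hne : c (a, b, i, j) = 0
      · rw [hne, zero_smul]
      · rw [hz i j hij a b hne, iterate_map_zero, mul_zero, smul_zero]
    rw [Finset.sum_eq_single m, Finset.sum_eq_single l, hue, hve, smul_smul]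
    · have hsm : ∀ (r : k) (G : k⟦X⟧), (PowerSeries.derivative k)^[b] (r • G)
          = r • (PowerSeries.derivative k)^[b] G := by
        intro r G
        induction (b : ℕ) with
        | zero => rfl
        | succ b ih => simp only [Function.iterate_succ_apply', ih, Derivation.map_smul]
      rw [hsm, mul_smul_comm, smul_comm]
    · exact fun j _ hj => hzero m j fun h => hj (Prod.ext_iff.1 h).2
    · simp
    · exact fun i _ hi => Finset.sum_eq_zero fun j _ => hzero i j fun h => hi (Prod.ext_iff.1 h).1
    · simp
  simp only [hin, ← Finset.smul_sum] at key
  exact (smul_eq_zero.1 key).resolve_left (mul_ne_zero he he')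

end Telescoping

end QuarterPlane

namespace QuarterPlane

/-! ### The order of the group -/

section Group

/-- The variables of `ℂ(x, y)`. -/
noncomputable abbrev var (i : Fin 2) : RatXY := algebraMap Poly RatXY (MvPolynomial.X i)

theorem var_ne_zero (i : Fin 2) : var i ≠ 0 := by simp [var]

theorem algebraMap_sidePoly (c : ℤ → ℂ) (i : Fin 2) : algebraMap Poly RatXY (sidePoly c i)
    = algebraMap ℂ RatXY (c (-1)) + algebraMap ℂ RatXY (c 0) * var i
      + algebraMap ℂ RatXY (c 1) * var i ^ 2 := by
  have hC : ∀ z : ℂ, algebraMap Poly RatXY (MvPolynomial.C z) = algebraMap ℂ RatXY z := fun z => by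
    rw [← MvPolynomial.algebraMap_eq, ← IsScalarTower.algebraMap_apply]
  simp only [sidePoly, map_add, map_mul, map_pow, hC, var]

theorem algebraMap_sidePoly_ne_zero {c : ℤ → ℂ} (i : Fin 2)
    (h : ¬ (c (-1) = 0 ∧ c 0 = 0 ∧ c 1 = 0)) :
    algebraMap Poly RatXY (sidePoly c i) ≠ 0 := by
  simpa using sidePoly_ne_zero c i h

/-- The ratio of two sides, as a function of the variable `X j`. -/
noncomputable def sideRatio (j : Fin 2) (c d : ℤ → ℂ) : RatXY :=
  algebraMap Poly RatXY (sidePoly c j) / algebraMap Poly RatXY (sidePoly d j)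

theorem sideRatio_ne_zero {c d : ℤ → ℂ} (j : Fin 2) (hc : ¬ (c (-1) = 0 ∧ c 0 = 0 ∧ c 1 = 0))
    (hd : ¬ (d (-1) = 0 ∧ d 0 = 0 ∧ d 1 = 0)) : sideRatio j c d ≠ 0 :=
  div_ne_zero (algebraMap_sidePoly_ne_zero j hc) (algebraMap_sidePoly_ne_zero j hd)

theorem map_sidePoly_of_fixed {g : RatXY ≃ₐ[ℂ] RatXY} {j : Fin 2} (hg : g (var j) = var j)
    (c : ℤ → ℂ) :
    g (algebraMap Poly RatXY (sidePoly c j)) = algebraMap Poly RatXY (sidePoly c j) := by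
  simp only [algebraMap_sidePoly, map_add, map_mul, map_pow, hg, AlgEquiv.commutes]

theorem map_sideRatio_of_fixed {g : RatXY ≃ₐ[ℂ] RatXY} {j : Fin 2} (hg : g (var j) = var j)
    (c d : ℤ → ℂ) : g (sideRatio j c d) = sideRatio j c d := by
  simp only [sideRatio, map_div₀, map_sidePoly_of_fixed hg]

/-- If `c` and `d` are symmetric under `z ↦ l / z`, then so is the quotient of the sides. -/
theorem map_sideRatio_of_flip {g : RatXY ≃ₐ[ℂ] RatXY} {j : Fin 2} {l : ℂ} (hl : l ≠ 0)
    (hg : g (var j) = algebraMap ℂ RatXY l / var j) {c d : ℤ → ℂ}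
    (hc : c (-1) = l * c 1) (hd : d (-1) = l * d 1) : g (sideRatio j c d) = sideRatio j c d := by
  have hz := var_ne_zero j
  have hl' : algebraMap ℂ RatXY l ≠ 0 := by simpa using hl
  have key : ∀ e : ℤ → ℂ, e (-1) = l * e 1 → g (algebraMap Poly RatXY (sidePoly e j))
      = algebraMap ℂ RatXY l / var j ^ 2 * algebraMap Poly RatXY (sidePoly e j) := by
    intro e he
    simp only [algebraMap_sidePoly, map_add, map_mul, map_pow, hg, AlgEquiv.commutes, he]
    field_simp
    ring
  rw [sideRatio, map_div₀, key c hc, key d hd, mul_div_mul_left _ _ (by positivity)]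

/-- Polynomials in `x, y` as polynomials in the variable `X i` over the other variable. -/
noncomputable def separate (i : Fin 2) : Poly →ₐ[ℂ] Polynomial (Polynomial ℂ) :=
  MvPolynomial.aeval fun k => if k = i then Polynomial.X else Polynomial.C Polynomial.X

theorem separate_X_self (i : Fin 2) : separate i (MvPolynomial.X i) = Polynomial.X := by
  simp [separate]

theorem separate_C (i : Fin 2) (z : ℂ) :
    separate i (MvPolynomial.C z) = Polynomial.C (Polynomial.C z) := by
  rw [← MvPolynomial.algebraMap_eq, AlgHom.commutes]
  rfl

/-- The polynomial with coefficients `c (-1), c 0, c 1`. -/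
noncomputable def quadratic (c : ℤ → ℂ) : Polynomial ℂ :=
  Polynomial.C (c (-1)) + Polynomial.C (c 0) * Polynomial.X + Polynomial.C (c 1) * Polynomial.X ^ 2

theorem separate_sidePoly {i j : Fin 2} (hij : j ≠ i) (c : ℤ → ℂ) :
    separate i (sidePoly c j) = Polynomial.C (quadratic c) := by
  have hX : separate i (MvPolynomial.X j) = Polynomial.C Polynomial.X := by simp [separate, hij]
  simp only [sidePoly, quadratic, map_add, map_mul, map_pow, hX, separate_C]

theorem quadratic_eq_zero {c : ℤ → ℂ} (h : quadratic c = 0) : c (-1) = 0 ∧ c 0 = 0 ∧ c 1 = 0 := by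
  refine ⟨?_, ?_, ?_⟩
  · simpa [quadratic] using congrArg (fun p => Polynomial.coeff p 0) h
  · simpa [quadratic, Polynomial.coeff_X, Polynomial.coeff_C]
      using congrArg (fun p => Polynomial.coeff p 1) h
  · simpa [quadratic, Polynomial.coeff_X, Polynomial.coeff_C]
      using congrArg (fun p => Polynomial.coeff p 2) h

/-- Equality would give `c = z ^ 2 * d` with `z` the variable `X i`, while both sides involve only
the other variable; the coefficient of `z ^ 2` would force `d = 0`. -/
theorem sideRatio_div_ne {i j : Fin 2} (hij : j ≠ i) {c d : ℤ → ℂ}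
    (hd : ¬ (d (-1) = 0 ∧ d 0 = 0 ∧ d 1 = 0)) :
    sideRatio j c d / var i ≠ var i := by
  intro h
  have hd' := algebraMap_sidePoly_ne_zero j hd
  have hz := var_ne_zero i
  rw [sideRatio, div_eq_iff hz, div_eq_iff hd'] at h
  have h' : sidePoly c j = MvPolynomial.X i * MvPolynomial.X i * sidePoly d j :=
    IsFractionRing.injective Poly RatXY (by rw [h]; simp [var])
  have h2 := congrArg (fun p => (separate i p).coeff 2) h'
  simp only [map_mul, separate_X_self, separate_sidePoly hij] at h2
  rw [← pow_two, mul_comm, Polynomial.coeff_C_mul_X_pow, Polynomial.coeff_C] at h2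
  exact hd (quadratic_eq_zero (by simpa using h2.symm))

variable {a : Model} (ha : Interesting a)

theorem Phi_var_zero :
    Phi a ha (var 0) = sideRatio 1 (fun v => a (-1) v) (fun v => a 1 v) / var 0 := by
  refine (Phi_x a ha).trans ?_
  rw [sideRatio, ← side_mul, ← side_mul, mul_div_mul_right _ _ (var_ne_zero 1), one_div_mul_eq_div]
  rfl

theorem Psi_var_one :
    Psi a ha (var 1) = sideRatio 0 (fun u => a u (-1)) (fun u => a u 1) / var 1 := by
  refine (Psi_y a ha).trans ?_
  rw [sideRatio, ← side_mul, ← side_mul, mul_div_mul_right _ _ (var_ne_zero 0), one_div_mul_eq_div]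
  rfl

theorem Phi_var_one : Phi a ha (var 1) = var 1 := Phi_y a ha

theorem Psi_var_zero : Psi a ha (var 0) = var 0 := Psi_x a ha

theorem algEquiv_eq_of_var {g h : RatXY ≃ₐ[ℂ] RatXY} (h0 : g (var 0) = h (var 0))
    (h1 : g (var 1) = h (var 1)) : g = h := by
  have : (g : RatXY →ₐ[ℂ] RatXY) = h := by
    apply IsLocalization.algHom_ext (nonZeroDivisors Poly)
    apply MvPolynomial.algHom_ext
    intro k
    fin_cases k
    exacts [h0, h1]
  ext z
  exact DFunLike.congr_fun this z

theorem Phi_mul_self : Phi a ha * Phi a ha = 1 := by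
  have hr := sideRatio_ne_zero (c := fun v => a (-1) v) (d := fun v => a 1 v) 1
    (fun h => ha (Or.inr (Or.inr (Or.inl h)))) (fun h => ha (Or.inl h))
  refine algEquiv_eq_of_var ?_ ?_
  · rw [AlgEquiv.mul_apply, Phi_var_zero, map_div₀, Phi_var_zero,
      map_sideRatio_of_fixed (Phi_var_one ha), div_div_cancel₀ hr, AlgEquiv.one_apply]
  · rw [AlgEquiv.mul_apply, Phi_var_one, Phi_var_one, AlgEquiv.one_apply]

theorem Psi_mul_self : Psi a ha * Psi a ha = 1 := by
  have hr := sideRatio_ne_zero (c := fun u => a u (-1)) (d := fun u => a u 1) 0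
    (fun h => ha (Or.inr (Or.inr (Or.inr h))))
    (fun h => ha (Or.inr (Or.inl h)))
  refine algEquiv_eq_of_var ?_ ?_
  · rw [AlgEquiv.mul_apply, Psi_var_zero, Psi_var_zero, AlgEquiv.one_apply]
  · rw [AlgEquiv.mul_apply, Psi_var_one, map_div₀, Psi_var_one,
      map_sideRatio_of_fixed (Psi_var_zero ha), div_div_cancel₀ hr, AlgEquiv.one_apply]

theorem Phi_var_ne : Phi a ha (var 0) ≠ var 0 := by
  rw [Phi_var_zero]
  exact sideRatio_div_ne (by decide) fun h => ha (Or.inl h)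

theorem Psi_var_ne : Psi a ha (var 1) ≠ var 1 := by
  rw [Psi_var_one]
  exact sideRatio_div_ne (by decide) fun h => ha (Or.inr (Or.inl h))

/-- In the first case `Phi` sends x to l/x. The same proportionality makes each horizontal side
invariant under this substitution up to a factor common to both, so the ratio in `Psi` is fixed. The
second case is the mirror image. -/
theorem commute_of_proportional
    (h : (∃ l : ℂ, l ≠ 0 ∧ Proportional a l) ∨ ∃ l : ℂ, l ≠ 0 ∧ Proportional a.reflect l) :
    Phi a ha * Psi a ha = Psi a ha * Phi a ha := by
  rcases h with ⟨l, hl, h⟩ | ⟨l, hl, h⟩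
  · have hPhi : Phi a ha (var 0) = algebraMap ℂ RatXY l / var 0 := by
      rw [Phi_var_zero]
      congr 1
      rw [sideRatio, div_eq_iff (algebraMap_sidePoly_ne_zero 1 fun h => ha (Or.inl h))]
      simp only [algebraMap_sidePoly, h (-1) (by decide), h 0 (by decide), h 1 (by decide), map_mul]
      ring
    refine algEquiv_eq_of_var ?_ ?_
    · rw [AlgEquiv.mul_apply, AlgEquiv.mul_apply, Psi_var_zero, hPhi, map_div₀, Psi_var_zero,
        AlgEquiv.commutes]
    · rw [AlgEquiv.mul_apply, AlgEquiv.mul_apply, Phi_var_one, Psi_var_one, map_div₀, Phi_var_one,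
        map_sideRatio_of_flip hl hPhi (h (-1) (by decide)) (h 1 (by decide))]
  · have hPsi : Psi a ha (var 1) = algebraMap ℂ RatXY l / var 1 := by
      rw [Psi_var_one]
      congr 1
      rw [sideRatio, div_eq_iff (algebraMap_sidePoly_ne_zero 0 fun h => ha (Or.inr (Or.inl h)))]
      have h' : ∀ v ∈ Finset.Icc (-1 : ℤ) 1, a v (-1) = l * a v 1 := h
      simp only [algebraMap_sidePoly, h' (-1) (by decide), h' 0 (by decide), h' 1 (by decide),
        map_mul]
      ring
    refine algEquiv_eq_of_var ?_ ?_
    · rw [AlgEquiv.mul_apply, AlgEquiv.mul_apply, Psi_var_zero, Phi_var_zero, map_div₀,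
        Psi_var_zero, map_sideRatio_of_flip hl hPsi (h (-1) (by decide)) (h 1 (by decide))]
    · rw [AlgEquiv.mul_apply, AlgEquiv.mul_apply, Phi_var_one, hPsi, map_div₀, Phi_var_one,
        AlgEquiv.commutes]

theorem isKleinFour_of_commute (h : Phi a ha * Psi a ha = Psi a ha * Phi a ha) :
    IsKleinFour (modelGroup a ha) := by
  set P := Phi a ha with hP
  set Q := Psi a ha with hQ
  have hPP : P * P = 1 := Phi_mul_self ha
  have hQQ : Q * Q = 1 := Psi_mul_self ha
  have hP1 : P (var 0) ≠ var 0 := Phi_var_ne ha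
  have hQ1 : Q (var 1) ≠ var 1 := Psi_var_ne ha
  have hQ0 : Q (var 0) = var 0 := Psi_var_zero ha
  have hset : (modelGroup a ha : Set (RatXY ≃ₐ[ℂ] RatXY)) = {1, P, Q, P * Q} := by
    apply Set.Subset.antisymm
    · intro g hg
      induction hg using Subgroup.closure_induction with
      | mem g hg => rcases hg with rfl | rfl <;> simp [hP, hQ]
      | one => simp
      | mul g g' _ _ hg hg' =>
        have h1 : Q * P = P * Q := h.symm
        have h2 : P * (P * Q) = Q := by rw [← mul_assoc, hPP, one_mul]
        have h3 : Q * (P * Q) = P := by rw [← mul_assoc, h1, mul_assoc, hQQ, mul_one]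
        rcases hg with rfl | rfl | rfl | rfl <;> rcases hg' with rfl | rfl | rfl | rfl <;>
          simp [hPP, hQQ, h1, h2, h3, mul_assoc]
      | inv g _ hg =>
        have h1 : P⁻¹ = P := inv_eq_of_mul_eq_one_left hPP
        have h2 : Q⁻¹ = Q := inv_eq_of_mul_eq_one_left hQQ
        rcases hg with rfl | rfl | rfl | rfl <;> simp [h1, h2, h]
    · have hPm : P ∈ modelGroup a ha := Subgroup.subset_closure (by simp [hP])
      have hQm : Q ∈ modelGroup a ha := Subgroup.subset_closure (by simp [hQ])
      rintro g (rfl | rfl | rfl | rfl)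
      exacts [one_mem _, hPm, hQm, mul_mem hPm hQm]
  have hsq : ∀ g : modelGroup a ha, g * g = 1 := by
    rintro ⟨g, hg⟩
    rw [← SetLike.mem_coe, hset] at hg
    refine Subtype.ext ?_
    have h3 : (P * Q) * (P * Q) = 1 := by
      rw [mul_assoc, ← mul_assoc Q, ← h, mul_assoc, hQQ, mul_one, hPP]
    rcases hg with rfl | rfl | rfl | rfl
    exacts [one_mul _, hPP, hQQ, h3]
  have hcard : Nat.card (modelGroup a ha) = 4 := by
    rw [← SetLike.coe_sort_coe, Nat.card_coe_set_eq, hset]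
    -- The four elements are told apart by their action on the variables: `P` moves x, `Q` fixes x
    -- and moves y.
    have e1 : P ≠ 1 := fun e => hP1 (by rw [e, AlgEquiv.one_apply])
    have e2 : Q ≠ 1 := fun e => hQ1 (by rw [e, AlgEquiv.one_apply])
    have e3 : P ≠ Q := fun e => hP1 (by rw [e, hQ0])
    have e4 : P * Q ≠ 1 := fun e => hP1 (by
      have := DFunLike.congr_fun e (var 0)
      rwa [AlgEquiv.mul_apply, hQ0, AlgEquiv.one_apply] at this)
    rw [Set.ncard_insert_of_notMem, Set.ncard_insert_of_notMem, Set.ncard_pair]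
    · simpa using e1
    · simp [e3, e2]
    · simp [Ne.symm e1, Ne.symm e2, Ne.symm e4]
  refine ⟨hcard, ?_⟩
  have : Finite (modelGroup a ha) := Nat.finite_of_card_ne_zero (by omega)
  have : Nontrivial (modelGroup a ha) := Finite.one_lt_card_iff_nontrivial.1 (by omega)
  exact (Monoid.exponent_eq_prime_iff Nat.prime_two).2 fun g hg =>
    orderOf_eq_prime (by rw [pow_two, hsq]) hg

theorem commute_of_mulEquiv (e : modelGroup a ha ≃* DihedralGroup 2) :
    Phi a ha * Psi a ha = Psi a ha * Phi a ha := by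
  have hc : ∀ g h : DihedralGroup 2, g * h = h * g := by decide
  have := e.injective (a₁ := ⟨Phi a ha, Subgroup.subset_closure (by simp)⟩
    * ⟨Psi a ha, Subgroup.subset_closure (by simp)⟩)
    (a₂ := ⟨Psi a ha, Subgroup.subset_closure (by simp)⟩
    * ⟨Phi a ha, Subgroup.subset_closure (by simp)⟩) (by rw [map_mul, map_mul, hc])
  exact congrArg Subtype.val this

/-- Two vectors with vanishing minors, both nonzero, are proportional. -/
theorem exists_ratio_of_minors {p q : ℤ → ℂ} (hp : ¬ (p (-1) = 0 ∧ p 0 = 0 ∧ p 1 = 0))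
    (hq : ¬ (q (-1) = 0 ∧ q 0 = 0 ∧ q 1 = 0)) (h1 : p 0 * q (-1) = p (-1) * q 0)
    (h2 : p 1 * q (-1) = p (-1) * q 1) (h3 : p 1 * q 0 = p 0 * q 1) :
    ∃ l : ℂ, l ≠ 0 ∧ ∀ v ∈ Finset.Icc (-1 : ℤ) 1, p v = l * q v := by
  have key : ∀ i ∈ Finset.Icc (-1 : ℤ) 1, ∀ j ∈ Finset.Icc (-1 : ℤ) 1, p i * q j = p j * q i := by
    have hI : Finset.Icc (-1 : ℤ) 1 = {-1, 0, 1} := by decide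
    simp only [hI, Finset.forall_mem_insert, Finset.mem_singleton, forall_eq]
    exact ⟨⟨trivial, h1.symm, h2.symm⟩, ⟨h1, trivial, h3.symm⟩, h2, h3, trivial⟩
  obtain ⟨i, hi, hqi⟩ : ∃ i ∈ Finset.Icc (-1 : ℤ) 1, q i ≠ 0 := by
    by_contra! h
    exact hq ⟨h _ (by decide), h _ (by decide), h _ (by decide)⟩
  have hall : ∀ v ∈ Finset.Icc (-1 : ℤ) 1, p v = p i / q i * q v := fun v hv => by
    rw [div_mul_eq_mul_div, eq_div_iff hqi, key v hv i hi]
  refine ⟨p i / q i, fun h0 => hp ?_, hall⟩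
  rw [h0] at hall
  simp only [zero_mul] at hall
  exact ⟨hall _ (by decide), hall _ (by decide), hall _ (by decide)⟩

/-- Invariance of p/q under x ↦ x' becomes, after removal of the trivial factor x' - x, a relation
in the symmetric functions of x and x'. Since x x' depends on y alone, it can be read as a quadratic
polynomial in x over ℂ[y]. -/
theorem proportional_of_commute (h : Phi a ha * Psi a ha = Psi a ha * Phi a ha) :
    (∃ l : ℂ, l ≠ 0 ∧ Proportional a l) ∨ ∃ l : ℂ, l ≠ 0 ∧ Proportional a.reflect l := by
  set p : ℤ → ℂ := fun u => a u (-1) with hp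
  set q : ℤ → ℂ := fun u => a u 1 with hq
  set r : ℤ → ℂ := fun v => a (-1) v with hr
  set s : ℤ → ℂ := fun v => a 1 v with hs
  have hp0 : ¬ (p (-1) = 0 ∧ p 0 = 0 ∧ p 1 = 0) := fun h => ha (Or.inr (Or.inr (Or.inr h)))
  have hq0 : ¬ (q (-1) = 0 ∧ q 0 = 0 ∧ q 1 = 0) := fun h => ha (Or.inr (Or.inl h))
  have hr0 : ¬ (r (-1) = 0 ∧ r 0 = 0 ∧ r 1 = 0) := fun h => ha (Or.inr (Or.inr (Or.inl h)))
  have hs0 : ¬ (s (-1) = 0 ∧ s 0 = 0 ∧ s 1 = 0) := fun h => ha (Or.inl h)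
  have hx := var_ne_zero 0
  have hy := var_ne_zero 1
  have hS := algebraMap_sidePoly_ne_zero 1 hs0
  have hQ := algebraMap_sidePoly_ne_zero 0 hq0
  have hPhi : Phi a ha (var 0) = sideRatio 1 r s / var 0 := Phi_var_zero ha
  have hne : Phi a ha (var 0) ≠ var 0 := Phi_var_ne ha
  -- the ratio of the horizontal sides is invariant under `Phi`
  have hinv : Phi a ha (sideRatio 0 p q) = sideRatio 0 p q := by
    have := DFunLike.congr_fun h (var 1)
    rw [AlgEquiv.mul_apply, AlgEquiv.mul_apply, Phi_var_one, Psi_var_one, map_div₀, Phi_var_one,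
      div_left_inj' hy] at this
    exact this
  have hQ' : Phi a ha (algebraMap Poly RatXY (sidePoly q 0)) ≠ 0 :=
    (map_ne_zero_iff _ (Phi a ha).injective).2 hQ
  rw [sideRatio, map_div₀, div_eq_div_iff hQ' hQ] at hinv
  simp only [algebraMap_sidePoly p, algebraMap_sidePoly q, map_add, map_mul, map_pow,
    AlgEquiv.commutes] at hinv
  set x' := Phi a ha (var 0)
  -- This is p(x') q(x) - p(x) q(x') divided by x' - x.
  have hfac : algebraMap ℂ RatXY (p 0 * q (-1) - p (-1) * q 0)
      + algebraMap ℂ RatXY (p 1 * q (-1) - p (-1) * q 1) * (x' + var 0)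
      + algebraMap ℂ RatXY (p 1 * q 0 - p 0 * q 1) * (x' * var 0) = 0 := by
    refine (mul_eq_zero.1 ?_).resolve_left (sub_ne_zero.2 hne)
    simp only [map_sub, map_mul]
    linear_combination hinv
  have hx' : x' * var 0 * algebraMap Poly RatXY (sidePoly s 1)
      = algebraMap Poly RatXY (sidePoly r 1) := by
    rw [hPhi, sideRatio]
    field_simp
  have hC : ∀ z : ℂ, algebraMap Poly RatXY (MvPolynomial.C z) = algebraMap ℂ RatXY z := fun z => by
    rw [← MvPolynomial.algebraMap_eq, ← IsScalarTower.algebraMap_apply]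
  -- The preceding relation times x s(y), with x x' s(y) replaced by r(y).
  have hpoly : MvPolynomial.C (p 1 * q (-1) - p (-1) * q 1) * sidePoly s 1 * MvPolynomial.X 0 ^ 2
      + (MvPolynomial.C (p 0 * q (-1) - p (-1) * q 0) * sidePoly s 1
        + MvPolynomial.C (p 1 * q 0 - p 0 * q 1) * sidePoly r 1) * MvPolynomial.X 0
      + MvPolynomial.C (p 1 * q (-1) - p (-1) * q 1) * sidePoly r 1 = (0 : Poly) := by
    refine IsFractionRing.injective Poly RatXY ?_
    rw [map_zero]
    simp only [map_add, map_mul, map_pow, hC, ← hx']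
    linear_combination (var 0 * algebraMap Poly RatXY (sidePoly s 1)) * hfac
  have hsep := congrArg (separate 0) hpoly
  simp only [map_add, map_mul, map_pow, separate_X_self, separate_C,
    separate_sidePoly (show (1 : Fin 2) ≠ 0 by decide), map_zero] at hsep
  simp only [← Polynomial.C_mul, ← Polynomial.C_add] at hsep
  generalize h20 : p 1 * q (-1) - p (-1) * q 1 = m20 at hsep
  generalize h10 : p 0 * q (-1) - p (-1) * q 0 = m10 at hsep
  generalize h21 : p 1 * q 0 - p 0 * q 1 = m21 at hsep
  -- The coefficient of x² kills the minor `m20`; that of x says m10 s + m21 r = 0. If `m21` is zero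
  -- then so is `m10`, and p, q are proportional; otherwise r is a multiple of s.
  have h2 := congrArg (fun P => Polynomial.coeff P 2) hsep
  have h1 := congrArg (fun P => Polynomial.coeff P 1) hsep
  simp only [Polynomial.coeff_add, Polynomial.coeff_C_mul_X_pow, Polynomial.coeff_C_mul_X,
    Polynomial.coeff_C, Polynomial.coeff_zero] at h1 h2
  norm_num at h1 h2
  have hs1 : quadratic s ≠ 0 := fun h => hs0 (quadratic_eq_zero h)
  have hr1 : quadratic r ≠ 0 := fun h => hr0 (quadratic_eq_zero h)
  replace h2 : m20 = 0 := h2.resolve_right hs1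
  by_cases hm : m21 = 0
  · have hm' : m10 = 0 := by simpa [hm, hs1] using h1
    obtain ⟨l, hl, h⟩ := exists_ratio_of_minors hp0 hq0 (sub_eq_zero.1 (h10.trans hm'))
      (sub_eq_zero.1 (h20.trans h2)) (sub_eq_zero.1 (h21.trans hm))
    exact Or.inr ⟨l, hl, h⟩
  · have hv : ∀ v ∈ Finset.Icc (-1 : ℤ) 1, r v = -m10 / m21 * s v := by
      have h3 : quadratic (fun v => m10 * s v + m21 * r v) = 0 := by
        rw [← h1]
        simp only [quadratic, map_add, map_mul]
        ring
      obtain ⟨e1, e2, e3⟩ := quadratic_eq_zero h3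
      have hI : Finset.Icc (-1 : ℤ) 1 = {-1, 0, 1} := by decide
      simp only [hI, Finset.forall_mem_insert, Finset.mem_singleton, forall_eq]
      refine ⟨?_, ?_, ?_⟩ <;> rw [div_mul_eq_mul_div, eq_div_iff hm]
      exacts [by linear_combination e1, by linear_combination e2, by linear_combination e3]
    refine Or.inl ⟨-m10 / m21, fun h0 => hr0 ?_, hv⟩
    rw [h0] at hv
    simp only [zero_mul] at hv
    exact ⟨hv _ (by decide), hv _ (by decide), hv _ (by decide)⟩

theorem nonempty_mulEquiv_iff : Nonempty (modelGroup a ha ≃* DihedralGroup 2) ↔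
    (∃ l : ℂ, l ≠ 0 ∧ Proportional a l) ∨ ∃ l : ℂ, l ≠ 0 ∧ Proportional a.reflect l := by
  refine ⟨fun ⟨e⟩ => proportional_of_commute ha (commute_of_mulEquiv ha e), fun h => ?_⟩
  have := isKleinFour_of_commute ha (commute_of_proportional ha h)
  exact IsKleinFour.nonempty_mulEquiv

end Group
end QuarterPlane

namespace QuarterPlane

/-! ### The orbit sum -/

/-! ### Laurent polynomials: change of coefficients and the substitution T ↦ c/T. -/

section Laurent

variable {R S : Type*} [CommRing R] [CommRing S]

theorem coeff_C_mul_T_mul (r : R) (m j : ℤ) (p : R[T;T⁻¹]) :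
    (LaurentPolynomial.C r * LaurentPolynomial.T m * p).coeff j = r * p.coeff (j - m) := by
  rw [← LaurentPolynomial.single_eq_C_mul_T, AddMonoidAlgebra.coeff_single_mul_apply,
    neg_add_eq_sub]

theorem coeff_C_mul_T (r : R) (m j : ℤ) :
    (LaurentPolynomial.C r * LaurentPolynomial.T m).coeff j = if j = m then r else 0 := by
  rw [← LaurentPolynomial.single_eq_C_mul_T, AddMonoidAlgebra.coeff_single, Finsupp.single_apply]
  simp [eq_comm]

/-- The variable of a Laurent polynomial ring as a unit. -/
noncomputable def unitT (R : Type*) [CommRing R] : (R[T;T⁻¹])ˣ :=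
  ⟨LaurentPolynomial.T 1, LaurentPolynomial.T (-1),
      by rw [← LaurentPolynomial.T_add]; simp, by rw [← LaurentPolynomial.T_add]; simp⟩

theorem unitT_zpow (n : ℤ) : ((unitT R ^ n : (R[T;T⁻¹])ˣ) : R[T;T⁻¹]) = LaurentPolynomial.T n := by
  have h : ∀ n : ℕ, ((unitT R ^ n : (R[T;T⁻¹])ˣ) : R[T;T⁻¹]) = LaurentPolynomial.T n := by
    intro n
    rw [Units.val_pow_eq_pow_val, unitT, LaurentPolynomial.T_pow, mul_one]
  obtain ⟨n, rfl | rfl⟩ := n.eq_nat_or_neg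
  · rw [zpow_natCast, h]
  · rw [zpow_neg, zpow_natCast, ← LaurentPolynomial.invOf_T]
    refine (invOf_eq_right_inv ?_).symm
    rw [← h, Units.mul_inv]

/-- Apply a ring homomorphism to all coefficients. -/
noncomputable def mapCoeff (φ : R →+* S) : R[T;T⁻¹] →+* S[T;T⁻¹] :=
  LaurentPolynomial.eval₂ (LaurentPolynomial.C.comp φ) (unitT S)

@[simp]
theorem mapCoeff_C (φ : R →+* S) (r : R) :
    mapCoeff φ (LaurentPolynomial.C r) = LaurentPolynomial.C (φ r) := by
  simp [mapCoeff]

@[simp]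
theorem mapCoeff_T (φ : R →+* S) (n : ℤ) :
    mapCoeff φ (LaurentPolynomial.T n) = LaurentPolynomial.T n := by
  rw [mapCoeff, LaurentPolynomial.eval₂_T, unitT_zpow]

theorem coeff_mapCoeff (φ : R →+* S) (p : R[T;T⁻¹]) (j : ℤ) :
    (mapCoeff φ p).coeff j = φ (p.coeff j) := by
  induction p using LaurentPolynomial.induction_on' with
  | add p q hp hq => simp only [map_add, AddMonoidAlgebra.coeff_add, Finsupp.add_apply, hp, hq]
  | C_mul_T n a => rw [map_mul, mapCoeff_C, mapCoeff_T, coeff_C_mul_T, coeff_C_mul_T, apply_ite φ,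
      map_zero]

variable {K : Type*} [Field K]

/-- The substitution `T ↦ c T⁻¹`. -/
noncomputable def flipT (c : K) (hc : c ≠ 0) : K[T;T⁻¹] →+* K[T;T⁻¹] :=
  LaurentPolynomial.eval₂ LaurentPolynomial.C
    (Units.map (LaurentPolynomial.C : K →+* K[T;T⁻¹]).toMonoidHom (Units.mk0 c hc) * (unitT K)⁻¹)

@[simp]
theorem flipT_C (c : K) (hc : c ≠ 0) (r : K) :
    flipT c hc (LaurentPolynomial.C r) = LaurentPolynomial.C r := by
  simp [flipT]

@[simp]
theorem flipT_T (c : K) (hc : c ≠ 0) (n : ℤ) : flipT c hc (LaurentPolynomial.T n)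
    = LaurentPolynomial.C (c ^ n) * LaurentPolynomial.T (-n) := by
  rw [flipT, LaurentPolynomial.eval₂_T, mul_zpow, inv_zpow', Units.val_mul, unitT_zpow, ← map_zpow,
    Units.coe_map,
    Units.val_zpow_eq_zpow_val, Units.val_mk0]
  rfl

theorem coeff_flipT (c : K) (hc : c ≠ 0) (p : K[T;T⁻¹]) (j : ℤ) :
    (flipT c hc p).coeff j = c ^ (-j) * p.coeff (-j) := by
  induction p using LaurentPolynomial.induction_on' with
  | add p q hp hq =>
    simp only [map_add, AddMonoidAlgebra.coeff_add, Finsupp.add_apply, hp, hq, mul_add]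
  | C_mul_T n a =>
    rw [map_mul, flipT_C, flipT_T, ← mul_assoc, ← map_mul, coeff_C_mul_T, coeff_C_mul_T]
    rcases eq_or_ne j (-n) with rfl | h
    · simp [mul_comm]
    · rw [if_neg h, if_neg (by omega), mul_zero]

end Laurent

/-! ### The kernel equation, its antisymmetrization and the extraction of positive parts. -/

section OrbitSum

theorem walks_eq_zero_of_neg (a : Model) (n : ℕ) (i j : ℤ) (h : i < 0 ∨ j < 0) :
    walks a n i j = 0 := by
  cases n with
  | zero => rw [walks, if_neg]; omega
  | succ n => rw [walks, if_neg]; omega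

/-- The coefficient of `x^i y^j`. -/
noncomputable def coeffXY (p : ℂ[T;T⁻¹][T;T⁻¹]) (i j : ℤ) : ℂ := (p.coeff j).coeff i

theorem coeffXY_sub (p q : ℂ[T;T⁻¹][T;T⁻¹]) (i j : ℤ) :
    coeffXY (p - q) i j = coeffXY p i j - coeffXY q i j := rfl

theorem coeffXY_sum {ι : Type*} (s : Finset ι) (p : ι → ℂ[T;T⁻¹][T;T⁻¹]) (i j : ℤ) :
    coeffXY (∑ k ∈ s, p k) i j = ∑ k ∈ s, coeffXY (p k) i j := by
  simp [coeffXY, AddMonoidAlgebra.coeff_sum, Finsupp.finsetSum_apply]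

theorem ext_coeffXY {p q : ℂ[T;T⁻¹][T;T⁻¹]} (h : ∀ i j, coeffXY p i j = coeffXY q i j) : p = q :=
  LaurentPolynomial.ext fun j => LaurentPolynomial.ext fun i => h i j

/-- The monomial `c x^i y^j`. -/
noncomputable def monoXY (c : ℂ) (i j : ℤ) : ℂ[T;T⁻¹][T;T⁻¹] :=
  LaurentPolynomial.C (LaurentPolynomial.C c * LaurentPolynomial.T i) * LaurentPolynomial.T j

theorem coeffXY_monoXY_mul (c : ℂ) (m n i j : ℤ) (p : ℂ[T;T⁻¹][T;T⁻¹]) :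
    coeffXY (monoXY c m n * p) i j = c * coeffXY p (i - m) (j - n) := by
  rw [coeffXY, monoXY, coeff_C_mul_T_mul, coeff_C_mul_T_mul]
  rfl

theorem coeffXY_monoXY (c : ℂ) (m n i j : ℤ) :
    coeffXY (monoXY c m n) i j = if i = m ∧ j = n then c else 0 := by
  rw [coeffXY, monoXY, coeff_C_mul_T]
  split_ifs with h1 h2 h2
  · rw [coeff_C_mul_T, if_pos h2.1]
  · rw [coeff_C_mul_T, if_neg fun h => h2 ⟨h, h1⟩]
  · exact absurd h2.2 h1
  · rfl

theorem monoXY_mul (c d : ℂ) (m n i j : ℤ) :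
    monoXY c m n * monoXY d i j = monoXY (c * d) (m + i) (n + j) := by
  simp only [monoXY, LaurentPolynomial.T_add, map_mul]
  ring

theorem coeff_polyInclusion (a : Model) (n : ℕ) :
    PowerSeries.coeff n (polyInclusion (genFun a)) = ∑ i ∈ Finset.range (n + 1),
      ∑ j ∈ Finset.range (n + 1), monoXY (walks a n i j) i j := by
  simp only [polyInclusion, genFun, PowerSeries.coeff_map, PowerSeries.coeff_mk, map_sum, map_mul,
    map_pow, MvPolynomial.coe_eval₂Hom, MvPolynomial.eval₂_C, MvPolynomial.eval₂_X, monoXY]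
  simp [← map_pow, mul_assoc]

theorem coeffXY_polyInclusion (a : Model) (n : ℕ) (i j : ℤ) :
    coeffXY (PowerSeries.coeff n (polyInclusion (genFun a))) i j = walks a n i j := by
  rw [coeff_polyInclusion]
  simp only [coeffXY_sum, coeffXY_monoXY]
  by_cases hi : 0 ≤ i ∧ i ≤ n
  · by_cases hj : 0 ≤ j ∧ j ≤ n
    · obtain ⟨i, rfl⟩ := Int.eq_ofNat_of_zero_le hi.1
      obtain ⟨j, rfl⟩ := Int.eq_ofNat_of_zero_le hj.1
      rw [Finset.sum_eq_single i, Finset.sum_eq_single j]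
      · simp
      · intro b _ hb
        rw [if_neg]; omega
      · intro hb; simp at hb; omega
      · intro b _ hb
        refine Finset.sum_eq_zero fun c _ => if_neg ?_
        omega
      · intro hb; simp at hb; omega
    · rw [Finset.sum_eq_zero]
      · by_cases h : j < 0
        · rw [walks_eq_zero_of_neg _ _ _ _ (Or.inr h)]
        · rw [walks_eq_zero _ _ _ _ (Or.inr (by omega))]
      · refine fun b hb => Finset.sum_eq_zero fun c hc => if_neg ?_
        rw [Finset.mem_range] at hb hc
        omega
  · rw [Finset.sum_eq_zero]
    · by_cases h : i < 0
      · rw [walks_eq_zero_of_neg _ _ _ _ (Or.inl h)]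
      · rw [walks_eq_zero _ _ _ _ (Or.inl (by omega))]
    · refine fun b hb => Finset.sum_eq_zero fun c hc => if_neg ?_
      rw [Finset.mem_range] at hb hc
      omega

/-- `x y` times the coefficient of `t^n` in the generating function. -/
noncomputable def shifted (a : Model) (n : ℕ) : ℂ[T;T⁻¹][T;T⁻¹] :=
  monoXY 1 1 1 * PowerSeries.coeff n (polyInclusion (genFun a))

theorem coeffXY_shifted (a : Model) (n : ℕ) (i j : ℤ) :
    coeffXY (shifted a n) i j = walks a n (i - 1) (j - 1) := by
  rw [shifted, coeffXY_monoXY_mul, coeffXY_polyInclusion, one_mul]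

/-- The Laurent polynomial of the steps. -/
noncomputable def stepPoly (a : Model) : ℂ[T;T⁻¹][T;T⁻¹] :=
  ∑ d ∈ directions, monoXY (a d.1 d.2) d.1 d.2

/-- The terms of the kernel equation at `t^n` which stem from forbidden steps. -/
noncomputable def boundary (a : Model) (n : ℕ) : ℂ[T;T⁻¹][T;T⁻¹] :=
  stepPoly a * shifted a n - shifted a (n + 1)

/-- With positive indices this is the recurrence of the walks. If an index is negative, no step,
having components at least -1, starts from a point of the quarter plane, and all terms vanish. -/
theorem coeffXY_boundary (a : Model) (n : ℕ) {i j : ℤ} (hi : i ≠ 0) (hj : j ≠ 0) :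
    coeffXY (boundary a n) i j = 0 := by
  rw [boundary, coeffXY_sub, stepPoly, Finset.sum_mul, coeffXY_sum]
  simp only [coeffXY_monoXY_mul, coeffXY_shifted]
  rw [walks]
  split_ifs with h
  · rw [sub_eq_zero]
    refine Finset.sum_congr rfl fun d _ => ?_
    rw [sub_right_comm, sub_right_comm j]
  · rw [sub_zero]
    refine Finset.sum_eq_zero fun d hd => ?_
    have hd' : -1 ≤ d.1 ∧ -1 ≤ d.2 := by
      revert d; decide
    rw [walks_eq_zero_of_neg, mul_zero]
    omega

/-- The substitution `x ↦ l / x`. -/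
noncomputable def flipX (l : ℂ) (hl : l ≠ 0) : ℂ[T;T⁻¹][T;T⁻¹] →+* ℂ[T;T⁻¹][T;T⁻¹] :=
  mapCoeff (flipT l hl)

theorem coeffXY_flipX (l : ℂ) (hl : l ≠ 0) (p : ℂ[T;T⁻¹][T;T⁻¹]) (i j : ℤ) :
    coeffXY (flipX l hl p) i j = l ^ (-i) * coeffXY p (-i) j := by
  rw [coeffXY, flipX, coeff_mapCoeff, coeff_flipT]
  rfl

theorem flipX_monoXY (l : ℂ) (hl : l ≠ 0) (c : ℂ) (i j : ℤ) :
    flipX l hl (monoXY c i j) = monoXY (c * l ^ i) (-i) j := by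
  simp only [flipX, monoXY, map_mul, mapCoeff_C, mapCoeff_T, flipT_C, flipT_T]
  ring

/-- Boundary terms x^0 y^j are fixed by x ↦ l/x and cancel; all others have j = 0. -/
theorem flipX_boundary (l : ℂ) (hl : l ≠ 0) (a : Model) (n : ℕ) :
    ∃ g : ℂ[T;T⁻¹], boundary a n - flipX l hl (boundary a n) = LaurentPolynomial.C g := by
  refine ⟨(boundary a n - flipX l hl (boundary a n)).coeff 0, ext_coeffXY fun i j => ?_⟩
  by_cases hj : j = 0
  · subst hj
    simp [coeffXY]
  · have hr : coeffXY (LaurentPolynomial.C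
        ((boundary a n - flipX l hl (boundary a n)).coeff 0)) i j = 0 := by
      rw [coeffXY, LaurentPolynomial.C_apply, if_neg hj]; rfl
    rw [hr, coeffXY_sub, coeffXY_flipX]
    by_cases hi : i = 0
    · subst hi; simp
    · rw [coeffXY_boundary a n hi hj, coeffXY_boundary a n (neg_ne_zero.2 hi) hj, mul_zero,
        sub_zero]

theorem sum_directions {A : Type*} [AddCommMonoid A] (f : ℤ × ℤ → A) :
    ∑ d ∈ directions, f d = f (-1, -1) + (f (-1, 0) + (f (-1, 1) + (f (0, -1) + (f (0, 1)
      + (f (1, -1) + (f (1, 0) + f (1, 1))))))) := by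
  rw [directions]
  repeat rw [Finset.sum_insert (by decide)]
  rw [Finset.sum_singleton]

/-- The substitution exchanges a_{1,v} x and l a_{1,v} x⁻¹. -/
theorem flipX_stepPoly {l : ℂ} (hl : l ≠ 0) {a : Model} (h : Proportional a l) :
    flipX l hl (stepPoly a) = stepPoly a := by
  have h1 := h (-1) (by decide)
  have h2 := h 0 (by decide)
  have h3 := h 1 (by decide)
  simp only [stepPoly, sum_directions, map_add, flipX_monoXY, h1, h2, h3, zpow_neg, zpow_one,
    zpow_zero, neg_neg, neg_zero, mul_one]
  have e : ∀ c : ℂ, l * c * l⁻¹ = c := fun c => by field_simp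
  simp only [e]
  simp only [mul_comm l]
  ring

/-- The difference of `x y f` and its image under `x ↦ l / x`, at `t^n`. -/
noncomputable def halfOrbit (l : ℂ) (hl : l ≠ 0) (a : Model) (n : ℕ) : ℂ[T;T⁻¹][T;T⁻¹] :=
  shifted a n - flipX l hl (shifted a n)

theorem coeffXY_halfOrbit (l : ℂ) (hl : l ≠ 0) (a : Model) (n : ℕ) (i j : ℤ) :
    coeffXY (halfOrbit l hl a n) i j
      = walks a n (i - 1) (j - 1) - l ^ (-i) * walks a n (-i - 1) (j - 1) := by
  rw [halfOrbit, coeffXY_sub, coeffXY_flipX, coeffXY_shifted, coeffXY_shifted]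

theorem coeff_halfOrbit_of_nonpos (l : ℂ) (hl : l ≠ 0) (a : Model) (n : ℕ) {j : ℤ} (hj : j ≤ 0) :
    (halfOrbit l hl a n).coeff j = 0 := by
  refine LaurentPolynomial.ext fun i => ?_
  refine (coeffXY_halfOrbit l hl a n i j).trans ?_
  rw [walks_eq_zero_of_neg _ _ _ _ (Or.inr (by omega)),
    walks_eq_zero_of_neg _ _ _ _ (Or.inr (by omega))]
  simp

/-- The error term `g` is free of y, so the second antisymmetrization will remove it. -/
theorem halfOrbit_succ {l : ℂ} (hl : l ≠ 0) {a : Model} (h : Proportional a l) (n : ℕ) :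
    ∃ g : ℂ[T;T⁻¹], halfOrbit l hl a (n + 1)
      = stepPoly a * halfOrbit l hl a n - LaurentPolynomial.C g := by
  obtain ⟨g, hg⟩ := flipX_boundary l hl a n
  refine ⟨g, ?_⟩
  rw [← hg, boundary, halfOrbit, halfOrbit, map_sub, map_mul, flipX_stepPoly hl h]
  ring

/-- `x` times the side `∑_u a_{u,v} x^u` of a model with `a_{-1,v} = l a_{1,v}`. -/
noncomputable def sideX (a : Model) (l : ℂ) (v : ℤ) : RatFunc ℂ :=
  algebraMap ℂ (RatFunc ℂ) (a 1 v) * (algebraMap ℂ (RatFunc ℂ) l + RatFunc.X ^ 2)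
    + algebraMap ℂ (RatFunc ℂ) (a 0 v) * RatFunc.X

theorem sideX_ne_zero {l : ℂ} {a : Model} {v : ℤ} (h : ¬ (a 1 v = 0 ∧ a 0 v = 0)) :
    sideX a l v ≠ 0 := by
  have hX : (Polynomial.C (a 1 v) * (Polynomial.C l + Polynomial.X ^ 2)
      + Polynomial.C (a 0 v) * Polynomial.X : Polynomial ℂ) ≠ 0 := by
    intro h0
    refine h ⟨?_, ?_⟩
    · simpa [mul_add, Polynomial.coeff_X, Polynomial.coeff_C, Polynomial.coeff_X_pow]
        using congrArg (fun p => Polynomial.coeff p 2) h0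
    · simpa [mul_add, Polynomial.coeff_X, Polynomial.coeff_C, Polynomial.coeff_X_pow]
        using congrArg (fun p => Polynomial.coeff p 1) h0
  have := (map_ne_zero_iff _ (RatFunc.algebraMap_injective ℂ)).2 hX
  simpa [sideX, RatFunc.algebraMap_eq_C] using this

/-- The inclusion of Laurent polynomials in `x, y` in `ℂ(x)[y, y⁻¹]`. -/
noncomputable abbrev inclXY : ℂ[T;T⁻¹][T;T⁻¹] →+* (RatFunc ℂ)[T;T⁻¹] := mapCoeff laurentToRatFunc

theorem laurentToRatFunc_C_mul_T (c : ℂ) (i : ℤ) :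
    laurentToRatFunc (LaurentPolynomial.C c * LaurentPolynomial.T i)
      = algebraMap ℂ (RatFunc ℂ) c * RatFunc.X ^ i := by
  rw [laurentToRatFunc, LaurentPolynomial.eval₂_C_mul_T, Units.val_zpow_eq_zpow_val, Units.val_mk0]

theorem inclXY_monoXY (c : ℂ) (i j : ℤ) : inclXY (monoXY c i j)
    = LaurentPolynomial.C (algebraMap ℂ (RatFunc ℂ) c * RatFunc.X ^ i) * LaurentPolynomial.T j := by
  rw [monoXY, map_mul, mapCoeff_C, mapCoeff_T, laurentToRatFunc_C_mul_T]

/-- The geometric series in t is also an inverse of the kernel, and inverses are unique. -/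
theorem coeff_kernelInv (a : Model) (n : ℕ) :
    PowerSeries.coeff n (kernelInv a) = inclXY (stepPoly a) ^ n := by
  have hs : inclXY (stepPoly a) = ∑ d ∈ directions,
      LaurentPolynomial.C (algebraMap ℂ (RatFunc ℂ) (a d.1 d.2) * RatFunc.X ^ d.1)
        * LaurentPolynomial.T d.2 := by
    simp only [stepPoly, map_sum, inclXY_monoXY]
  have h : kernelInv a = PowerSeries.mk fun n => inclXY (stepPoly a) ^ n := by
    refine left_inv_eq_right_inv (a := kernel a) (by rw [mul_comm, kernel_mul_kernelInv]) ?_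
    rw [kernel, ← hs, sub_mul, one_mul, mul_assoc]
    ext n : 1
    cases n with
    | zero => simp
    | succ n =>
      rw [map_sub, PowerSeries.coeff_succ_X_mul, PowerSeries.coeff_C_mul, PowerSeries.coeff_mk,
        PowerSeries.coeff_mk, pow_succ', sub_self, PowerSeries.coeff_one, if_neg n.succ_ne_zero]
  rw [h, PowerSeries.coeff_mk]

/-- The ratio of the bottom side to the top side. -/
noncomputable def bottomTop (a : Model) (l : ℂ) : RatFunc ℂ := sideX a l (-1) / sideX a l 1

theorem sideX_one_ne_zero {l : ℂ} {a : Model} (ha : Interesting a) (h : Proportional a l) :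
    sideX a l 1 ≠ 0 :=
  sideX_ne_zero fun h0 => ha (Or.inr (Or.inl ⟨by rw [h 1 (by decide), h0.1, mul_zero], h0.2, h0.1⟩))

theorem sideX_neg_one_ne_zero {l : ℂ} {a : Model} (ha : Interesting a) (h : Proportional a l) :
    sideX a l (-1) ≠ 0 :=
  sideX_ne_zero fun h0 =>
    ha (Or.inr (Or.inr (Or.inr ⟨by rw [h (-1) (by decide), h0.1, mul_zero], h0.2, h0.1⟩)))

theorem bottomTop_ne_zero {l : ℂ} {a : Model} (ha : Interesting a) (h : Proportional a l) :
    bottomTop a l ≠ 0 := div_ne_zero (sideX_neg_one_ne_zero ha h) (sideX_one_ne_zero ha h)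

theorem inclXY_stepPoly {l : ℂ} {a : Model} (h : Proportional a l) :
    ∃ m, inclXY (stepPoly a) = LaurentPolynomial.C (sideX a l (-1) / RatFunc.X)
      * LaurentPolynomial.T (-1) + LaurentPolynomial.C m
      + LaurentPolynomial.C (sideX a l 1 / RatFunc.X) * LaurentPolynomial.T 1 := by
  have hX : (RatFunc.X : RatFunc ℂ) ≠ 0 := RatFunc.X_ne_zero
  have hv : ∀ v ∈ Finset.Icc (-1 : ℤ) 1, sideX a l v / RatFunc.X
      = algebraMap ℂ (RatFunc ℂ) (a (-1) v) * RatFunc.X ^ (-1 : ℤ)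
        + algebraMap ℂ (RatFunc ℂ) (a 0 v) * RatFunc.X ^ (0 : ℤ)
        + algebraMap ℂ (RatFunc ℂ) (a 1 v) * RatFunc.X ^ (1 : ℤ) := by
    intro v hv
    rw [sideX, h v hv, map_mul, zpow_neg, zpow_one, zpow_zero]
    field_simp
    ring
  refine ⟨algebraMap ℂ (RatFunc ℂ) (a (-1) 0) * RatFunc.X ^ (-1 : ℤ)
    + algebraMap ℂ (RatFunc ℂ) (a 1 0) * RatFunc.X ^ (1 : ℤ), ?_⟩
  simp only [stepPoly, sum_directions, map_add, inclXY_monoXY, hv (-1) (by decide),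
    hv 1 (by decide), LaurentPolynomial.T_zero]
  ring

/-- The substitution `y ↦ (∑_u a_{u,-1} x^u) / (y ∑_u a_{u,1} x^u)`. -/
noncomputable def flipY {l : ℂ} {a : Model} (ha : Interesting a) (h : Proportional a l) :
    (RatFunc ℂ)[T;T⁻¹] →+* (RatFunc ℂ)[T;T⁻¹] :=
  flipT (bottomTop a l) (bottomTop_ne_zero ha h)

/-- The ratio `bottomTop` is chosen so that the terms in y and y⁻¹ are exchanged. It is rational in
x, whence the coefficients in ℂ(x). -/
theorem flipY_stepPoly {l : ℂ} {a : Model} (ha : Interesting a) (h : Proportional a l) :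
    flipY ha h (inclXY (stepPoly a)) = inclXY (stepPoly a) := by
  have hX : (RatFunc.X : RatFunc ℂ) ≠ 0 := RatFunc.X_ne_zero
  have h1 := sideX_one_ne_zero ha h
  have h2 := sideX_neg_one_ne_zero ha h
  obtain ⟨m, hm⟩ := inclXY_stepPoly h
  have e1 : sideX a l (-1) / RatFunc.X * (bottomTop a l) ^ (-1 : ℤ) = sideX a l 1 / RatFunc.X := by
    rw [bottomTop, zpow_neg, zpow_one]
    field_simp
  have e2 : sideX a l 1 / RatFunc.X * (bottomTop a l) ^ (1 : ℤ) = sideX a l (-1) / RatFunc.X := by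
    rw [bottomTop, zpow_one]
    field_simp
  rw [hm, flipY]
  simp only [map_add, map_mul, flipT_C, flipT_T]
  simp only [← mul_assoc, ← map_mul, e1, e2, neg_neg]
  ring

/-- The full orbit sum at `t^n`. -/
noncomputable def fullOrbit {l : ℂ} (hl : l ≠ 0) {a : Model} (ha : Interesting a)
    (h : Proportional a l) (n : ℕ) : (RatFunc ℂ)[T;T⁻¹] :=
  inclXY (halfOrbit l hl a n) - flipY ha h (inclXY (halfOrbit l hl a n))

/-- Both the step polynomial and the y-free error term are fixed by `flipY`, so the error cancels
and a homogeneous recurrence remains. -/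
theorem fullOrbit_succ {l : ℂ} (hl : l ≠ 0) {a : Model} (ha : Interesting a)
    (h : Proportional a l) (n : ℕ) :
    fullOrbit hl ha h (n + 1) = inclXY (stepPoly a) * fullOrbit hl ha h n := by
  obtain ⟨g, hg⟩ := halfOrbit_succ hl h n
  rw [fullOrbit, hg, map_sub, map_sub, map_mul, map_mul, flipY_stepPoly, mapCoeff_C,
    fullOrbit, flipY, flipT_C]
  ring

theorem halfOrbit_zero (l : ℂ) (hl : l ≠ 0) (a : Model) :
    halfOrbit l hl a 0 = monoXY 1 1 1 - monoXY l (-1) 1 := by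
  have : shifted a 0 = monoXY 1 1 1 := ext_coeffXY fun i j => by
    rw [coeffXY_shifted, coeffXY_monoXY, walks]
    exact if_congr (by omega) rfl rfl
  rw [halfOrbit, this, flipX_monoXY]
  simp

theorem fullOrbit_zero {l : ℂ} (hl : l ≠ 0) {a : Model} (ha : Interesting a)
    (h : Proportional a l) : fullOrbit hl ha h 0
      = LaurentPolynomial.C (algebraMap ℂ (RatFunc ℂ) 1 * RatFunc.X ^ (1 : ℤ)
          - algebraMap ℂ (RatFunc ℂ) l * RatFunc.X ^ (-1 : ℤ))
        * (LaurentPolynomial.T 1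
          - LaurentPolynomial.C (bottomTop a l ^ (1 : ℤ)) * LaurentPolynomial.T (-1)) := by
  have : inclXY (halfOrbit l hl a 0) = LaurentPolynomial.C (algebraMap ℂ (RatFunc ℂ) 1
      * RatFunc.X ^ (1 : ℤ) - algebraMap ℂ (RatFunc ℂ) l * RatFunc.X ^ (-1 : ℤ))
        * LaurentPolynomial.T 1 := by
    rw [halfOrbit_zero, map_sub, inclXY_monoXY, inclXY_monoXY, map_sub, sub_mul]
  rw [fullOrbit, this, flipY, map_mul, flipT_C, flipT_T, mul_sub]

/-- The recurrence gives powers of the step polynomial, that is, the coefficients of 1/K. It remains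
to match the initial value with the numerator, which equals y² `sideX a l 1` - `sideX a l (-1)` up
to the prefactor. -/
theorem coeff_orbitSum {l : ℂ} (hl : l ≠ 0) {a : Model} (ha : Interesting a)
    (h : Proportional a l) (n : ℕ) :
    PowerSeries.coeff n (orbitSum a l) = fullOrbit hl ha h n := by
  have hpow : ∀ n, fullOrbit hl ha h n = inclXY (stepPoly a) ^ n * fullOrbit hl ha h 0 := by
    intro n
    induction n with
    | zero => simp
    | succ n ih => rw [fullOrbit_succ, ih, pow_succ']; ring
  have hX : (RatFunc.X : RatFunc ℂ) ≠ 0 := RatFunc.X_ne_zero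
  have h1 := sideX_one_ne_zero ha h
  simp only [orbitSum]
  rw [PowerSeries.coeff_C_mul, coeff_kernelInv, hpow, mul_comm]
  congr 1
  rw [fullOrbit_zero]
  have e0 : algebraMap ℂ (RatFunc ℂ) (a 1 1) * (algebraMap ℂ (RatFunc ℂ) l + RatFunc.X ^ 2)
    + algebraMap ℂ (RatFunc ℂ) (a 0 1) * RatFunc.X = sideX a l 1 := rfl
  have e1 : (algebraMap ℂ (RatFunc ℂ) 1 * RatFunc.X ^ (1 : ℤ)
      - algebraMap ℂ (RatFunc ℂ) l * RatFunc.X ^ (-1 : ℤ))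
      = (RatFunc.X ^ 2 - algebraMap ℂ (RatFunc ℂ) l) / (RatFunc.X * sideX a l 1) * sideX a l 1 := by
    rw [map_one, zpow_neg, zpow_one]
    field_simp
  have e2 : bottomTop a l ^ (1 : ℤ) * sideX a l 1
      = algebraMap ℂ (RatFunc ℂ) (a 1 (-1)) * (algebraMap ℂ (RatFunc ℂ) l + RatFunc.X ^ 2)
        + algebraMap ℂ (RatFunc ℂ) (a 0 (-1)) * RatFunc.X := by
    rw [bottomTop, zpow_one, div_mul_cancel₀ _ h1]
    rfl
  have e3 : (LaurentPolynomial.T 1 : (RatFunc ℂ)[T;T⁻¹])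
      = LaurentPolynomial.T (-1) * LaurentPolynomial.T 2 := by
    rw [← LaurentPolynomial.T_add]; rfl
  have e4 := congrArg (LaurentPolynomial.C (R := RatFunc ℂ)) e2
  have e5 := congrArg (LaurentPolynomial.C (R := RatFunc ℂ)) e0
  rw [e0, e1, e3, map_mul]
  rw [map_mul, map_add, map_mul, map_mul] at e4
  rw [map_add, map_mul, map_mul] at e5
  rw [map_mul, map_mul]
  set A := LaurentPolynomial.C ((RatFunc.X ^ 2 - algebraMap ℂ (RatFunc ℂ) l)
    / (RatFunc.X * sideX a l 1))
  linear_combination (A * LaurentPolynomial.T (-1)) * e4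
    + (A * LaurentPolynomial.T (-1) * LaurentPolynomial.T 2) * e5

theorem coeff_positivePart {R : Type*} [Semiring R] (p : R[T;T⁻¹]) (j : ℤ) :
    (positivePart p).coeff j = if 0 < j then p.coeff j else 0 := by
  rw [positivePart, AddMonoidAlgebra.coeff_ofCoeff, Finsupp.filter_apply]

/-- `halfOrbit` has only positive exponents of y, and its image under y ↦ c/y only negative ones. -/
theorem positivePart_fullOrbit {l : ℂ} (hl : l ≠ 0) {a : Model} (ha : Interesting a)
    (h : Proportional a l) (n : ℕ) :
    positivePart (fullOrbit hl ha h n) = inclXY (halfOrbit l hl a n) := by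
  ext j
  have e : (fullOrbit hl ha h n).coeff j = (inclXY (halfOrbit l hl a n)).coeff j
    - (flipY ha h (inclXY (halfOrbit l hl a n))).coeff j := rfl
  rw [coeff_positivePart, e, flipY, coeff_flipT, coeff_mapCoeff, coeff_mapCoeff]
  split_ifs with hj
  · rw [coeff_halfOrbit_of_nonpos (j := -j) _ _ _ _ (by omega), map_zero, mul_zero, sub_zero]
  · rw [coeff_halfOrbit_of_nonpos _ _ _ _ (by omega), map_zero]

theorem isPositivePart_orbitSum {l : ℂ} (hl : l ≠ 0) {a : Model} (ha : Interesting a)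
    (h : Proportional a l) : IsPositivePart (genFun a) (orbitSum a l) := by
  refine ⟨PowerSeries.mk fun n => halfOrbit l hl a n, ?_, ?_⟩
  · ext n : 1
    rw [yPositive, PowerSeries.coeff_mk, coeff_orbitSum hl ha h, positivePart_fullOrbit,
      laurentInclusion, PowerSeries.coeff_map, PowerSeries.coeff_mk]
    rfl
  · ext n : 1
    -- The same argument in x: x y f has positive exponents of x, its image under x ↦ l/x negative
    -- ones.
    have hpos : PowerSeries.coeff n (xPositive (PowerSeries.mk fun n => halfOrbit l hl a n))
        = shifted a n := by
      refine ext_coeffXY fun i j => ?_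
      have e : coeffXY (PowerSeries.coeff n (xPositive (PowerSeries.mk fun n =>
          halfOrbit l hl a n))) i j = (positivePart ((halfOrbit l hl a n).coeff j)).coeff i := by
        rw [xPositive, PowerSeries.coeff_mk, PowerSeries.coeff_mk]
        rfl
      rw [e, coeff_positivePart, coeffXY_shifted]
      split_ifs with hi
      · refine (coeffXY_halfOrbit l hl a n i j).trans ?_
        rw [walks_eq_zero_of_neg a n (-i - 1) _ (Or.inl (by omega)), mul_zero, sub_zero]
      · rw [walks_eq_zero_of_neg _ _ _ _ (Or.inl (by omega))]
    have hm : (LaurentPolynomial.C (LaurentPolynomial.T (-1)) * LaurentPolynomial.T (-1) :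
        ℂ[T;T⁻¹][T;T⁻¹]) = monoXY 1 (-1) (-1) := by
      rw [monoXY, map_one, one_mul]
    rw [PowerSeries.coeff_C_mul, hpos, hm, shifted, ← mul_assoc, monoXY_mul]
    simp [monoXY]

end OrbitSum
end QuarterPlane

namespace QuarterPlane

/-! ### Expansion at infinity -/

/-- Formal Laurent series, as a type that carries only the ring and algebra structures. -/
def Laurent (A : Type*) [Zero A] : Type _ := HahnSeries ℤ A

noncomputable instance {A : Type*} [CommRing A] : CommRing (Laurent A) :=
  inferInstanceAs (CommRing (HahnSeries ℤ A))

instance {A : Type*} [CommRing A] [IsDomain A] : IsDomain (Laurent A) :=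
  inferInstanceAs (IsDomain (HahnSeries ℤ A))

noncomputable instance {A : Type*} [Field A] : Field (Laurent A) :=
  inferInstanceAs (Field (HahnSeries ℤ A))

noncomputable instance {k A : Type*} [Field k] [CommRing A] [Algebra k A] : Algebra k (Laurent A) :=
  HahnSeries.instAlgebra (Γ := ℤ) (R := k) (A := A)

namespace Laurent

variable {k A : Type*} [Field k] [CommRing A] [Algebra k A]

/-- The coefficient of a Laurent series. -/
def coeff (f : Laurent A) (n : ℤ) : A := HahnSeries.coeff f n

@[ext]
theorem ext {f g : Laurent A} (h : ∀ n, f.coeff n = g.coeff n) : f = g :=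
  HahnSeries.ext (funext h)

theorem coeff_add (f g : Laurent A) (n : ℤ) : (f + g).coeff n = f.coeff n + g.coeff n := rfl

theorem coeff_sub (f g : Laurent A) (n : ℤ) : (f - g).coeff n = f.coeff n - g.coeff n := rfl

theorem coeff_neg (f : Laurent A) (n : ℤ) : (-f).coeff n = -f.coeff n := rfl

theorem coeff_zero (n : ℤ) : (0 : Laurent A).coeff n = 0 := rfl

theorem coeff_smul (c : k) (f : Laurent A) (n : ℤ) : (c • f).coeff n = c • f.coeff n := rfl

theorem coeff_one (n : ℤ) : (1 : Laurent A).coeff n = if n = 0 then 1 else 0 :=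
by
  refine HahnSeries.coeff_one.trans ?_
  congr

/-- The monomial `r w^n`. -/
noncomputable def single (n : ℤ) (r : A) : Laurent A := HahnSeries.single n r

theorem coeff_single (n m : ℤ) (r : A) : (single n r).coeff m = if m = n then r else 0 :=
by
  refine HahnSeries.coeff_single.trans ?_
  congr

theorem coeff_single_mul (n m : ℤ) (r : A) (f : Laurent A) :
    (single n r * f).coeff m = r * f.coeff (m - n) :=
  HahnSeries.coeff_single_mul

theorem single_mul_single (m n : ℤ) (r s : A) : single m r * single n s = single (m + n) (r * s) :=
  HahnSeries.single_mul_single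

theorem single_zero (n : ℤ) : single n (0 : A) = 0 := HahnSeries.single_eq_zero

theorem single_zero_one : single 0 (1 : A) = 1 := rfl

/-- The constant Laurent series. -/
noncomputable def C : A →+* Laurent A := HahnSeries.C

theorem C_eq_single (r : A) : C r = single 0 r := rfl

theorem algebraMap_eq (c : k) : algebraMap k (Laurent A) c = C (algebraMap k A c) := rfl

theorem coeff_C_mul (r : A) (f : Laurent A) (m : ℤ) : (C r * f).coeff m = r * f.coeff m := by
  rw [C_eq_single, coeff_single_mul, sub_zero]

/-- The primed series vanish wherever the originals do, so all three products can be summed over the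
supports of `f` and `g`, and the Leibniz rule applies term by term. -/
theorem coeff_mul_of_leibniz {φ : ℤ → A →ₗ[k] A}
    (h : ∀ i j a b, φ (i + j) (a * b) = a * φ j b + b * φ i a) {f g f' g' : HahnSeries ℤ A}
    (hf : ∀ n, f'.coeff n = φ n (f.coeff n)) (hg : ∀ n, g'.coeff n = φ n (g.coeff n)) (n : ℤ) :
    φ n ((f * g).coeff n) = (f * g' + g * f').coeff n := by
  have hs : ∀ {e e' : HahnSeries ℤ A}, (∀ n, e'.coeff n = φ n (e.coeff n)) →
      e'.support ⊆ e.support := fun he m hm hm0 => hm (by simp only [he, hm0, map_zero])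
  rw [mul_comm g, HahnSeries.coeff_add, HahnSeries.coeff_mul, map_sum,
    HahnSeries.coeff_mul_right' g.isPWO_support (hs hg),
    HahnSeries.coeff_mul_left' f.isPWO_support (hs hf), ← Finset.sum_add_distrib]
  refine Finset.sum_congr rfl fun ij hij => ?_
  rw [← (Finset.mem_antidiagonal.1 hij).2.2, h, hf, hg, mul_comm (g.coeff _)]

/-- The derivation that acts on the coefficients by linear maps which satisfy a Leibniz rule. -/
noncomputable def derivationOfCoeff (φ : ℤ → A →ₗ[k] A)
    (h : ∀ i j a b, φ (i + j) (a * b) = a * φ j b + b * φ i a) :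
    Derivation k (Laurent A) (Laurent A) :=
  have hs : ∀ f : HahnSeries ℤ A, (Function.support fun n : ℤ => φ n (f.coeff n)) ⊆ f.support :=
    fun f n hn hn0 => hn (by simp only [hn0, map_zero])
  Derivation.mk'
    { toFun := fun f =>
        (⟨fun n => φ n (f.coeff n), (HahnSeries.isPWO_support f).mono (hs f)⟩ : HahnSeries ℤ A)
      map_add' := fun f g => ext fun n => map_add (φ n) _ _
      map_smul' := fun c f => ext fun n => map_smul (φ n) c _ }
    fun _ _ => ext fun n => coeff_mul_of_leibniz h (fun _ => rfl) (fun _ => rfl) n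

/-- A derivation of the coefficients, extended to Laurent series. -/
noncomputable def mapDerivation (d : Derivation k A A) : Derivation k (Laurent A) (Laurent A) :=
  derivationOfCoeff (fun _ => d) fun _ _ a b => d.leibniz a b

theorem coeff_mapDerivation (d : Derivation k A A) (f : Laurent A) (n : ℤ) :
    (mapDerivation d f).coeff n = d (f.coeff n) := rfl

theorem mapDerivation_single (d : Derivation k A A) (n : ℤ) (r : A) :
    mapDerivation d (single n r) = single n (d r) := by
  ext m
  rw [coeff_mapDerivation, coeff_single, coeff_single]
  split_ifs <;> simp

variable (k A) in
/-- The Euler derivation, which multiplies the coefficient at `n` by `n`. -/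
noncomputable def euler : Derivation k (Laurent A) (Laurent A) :=
  derivationOfCoeff (fun n => LinearMap.mulLeft k (n : A)) fun i j a b => by
    simp only [LinearMap.mulLeft_apply]; push_cast; ring

variable (k A) in
/-- The derivation `d/du` of Laurent series in `w = u⁻¹`. -/
noncomputable def derivation : Derivation k (Laurent A) (Laurent A) :=
  -(single (1 : ℤ) (1 : A) • euler k A)

/-- With w = u⁻¹, d/du is -w times the Euler operator w d/dw. At `n = 1`, the residue in u, the
factor `n - 1` vanishes: derivatives have no residue. -/
theorem coeff_derivation (f : Laurent A) (n : ℤ) :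
    (derivation k A f).coeff n = -((n - 1 : ℤ) * f.coeff (n - 1)) := by
  have : derivation k A f = -(single (1 : ℤ) (1 : A) * euler k A f) := rfl
  rw [this, coeff_neg, coeff_single_mul, one_mul]
  rfl

theorem derivation_single : derivation k A (single (-1) 1) = 1 := by
  ext n
  rw [coeff_derivation, coeff_one, coeff_single]
  split_ifs with h1 h2 h2
  · rw [h2]; simp
  · omega
  · omega
  · simp

theorem derivation_C (r : A) : derivation k A (C r) = 0 := by
  ext n
  rw [coeff_derivation, C_eq_single, coeff_single, coeff_zero]
  split_ifs with h
  · rw [h]; simp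
  · simp

/-- The expansion of `1 / (u - z)` in powers of `w = u⁻¹`. -/
noncomputable def geometric (z : A) : Laurent A :=
  HahnSeries.ofSuppBddBelow (fun n => if 1 ≤ n then z ^ (n - 1).toNat else 0)
    ⟨1, fun n hn => by by_contra h; exact hn (if_neg h)⟩

theorem coeff_geometric (z : A) (n : ℤ) :
    (geometric z).coeff n = if 1 ≤ n then z ^ (n - 1).toNat else 0 := rfl

theorem sub_mul_geometric (z : A) : (single (-1 : ℤ) (1 : A) - C z) * geometric z = 1 := by
  ext n
  rw [sub_mul, coeff_sub, coeff_single_mul, coeff_C_mul, coeff_geometric, coeff_geometric,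
    coeff_one, one_mul]
  rcases lt_trichotomy n 0 with h | rfl | h
  · rw [if_neg (by omega), if_neg (by omega), if_neg (by omega)]; simp
  · simp
  · rw [if_pos (by omega), if_pos (by omega), if_neg (by omega), ← pow_succ', sub_eq_zero]
    congr 1
    omega

end Laurent

/-! ### Derivations on power series in t. -/

section PowerSeries

variable {k A : Type*} [Field k] [CommRing A] [Algebra k A]

/-- A derivation of the coefficients, extended to power series. -/
noncomputable def powerSeriesMapDerivation (d : Derivation k A A) :
    Derivation k A⟦X⟧ A⟦X⟧ :=
  Derivation.mk'
    { toFun := fun f => PowerSeries.mk fun n => d (PowerSeries.coeff n f)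
      map_add' := fun f g => by ext; simp
      map_smul' := fun c f => by ext; simp }
    fun f g => by
      ext n
      simp only [LinearMap.coe_mk, AddHom.coe_mk, smul_eq_mul, map_add, PowerSeries.coeff_mk]
      rw [mul_comm g]
      simp only [PowerSeries.coeff_mul, map_sum, PowerSeries.coeff_mk, Derivation.leibniz,
        smul_eq_mul]
      rw [← Finset.sum_add_distrib]
      refine Finset.sum_congr rfl fun ij _ => ?_
      rw [mul_comm (PowerSeries.coeff _ g)]

theorem coeff_powerSeriesMapDerivation (d : Derivation k A A) (f : A⟦X⟧) (n : ℕ) :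
    PowerSeries.coeff n (powerSeriesMapDerivation d f) = d (PowerSeries.coeff n f) :=
  PowerSeries.coeff_mk n fun n => d (PowerSeries.coeff n f)

theorem powerSeriesMapDerivation_C (d : Derivation k A A) (r : A) :
    powerSeriesMapDerivation d (PowerSeries.C r) = PowerSeries.C (d r) := by
  ext n
  rw [coeff_powerSeriesMapDerivation, PowerSeries.coeff_C, PowerSeries.coeff_C]
  split_ifs <;> simp

theorem powerSeriesMapDerivation_X (d : Derivation k A A) :
    powerSeriesMapDerivation d PowerSeries.X = 0 := by
  ext n
  rw [coeff_powerSeriesMapDerivation, PowerSeries.coeff_X]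
  split_ifs <;> simp

variable (k A) in
/-- The derivation `d/dt`, as a derivation over a subfield of the coefficients. -/
noncomputable def timeDerivation : Derivation k A⟦X⟧ A⟦X⟧ :=
  (PowerSeries.derivative A).restrictScalars k

theorem timeDerivation_apply (f : A⟦X⟧) :
    timeDerivation k A f = PowerSeries.derivative A f := rfl

end PowerSeries

/-! ### The double residue and its compatibility with the three derivations. -/

section Expansion

variable (k : Type*) [Field k]

/-- The double residue of a power series over Laurent series. -/
noncomputable def residue : (Laurent (Laurent k))⟦X⟧ →ₗ[k] k⟦X⟧ where
  toFun G := PowerSeries.mk fun n => ((PowerSeries.coeff n G).coeff 1).coeff 1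
  map_add' f g := by ext n; simp [Laurent.coeff_add]
  map_smul' c f := by ext n; simp [Laurent.coeff_smul]

theorem coeff_residue (G : (Laurent (Laurent k))⟦X⟧) (n : ℕ) :
    PowerSeries.coeff n (residue k G) = ((PowerSeries.coeff n G).coeff 1).coeff 1 :=
  PowerSeries.coeff_mk n fun n => ((PowerSeries.coeff n G).coeff 1).coeff 1

/-- The outer variable `v` of the ring of expansions. -/
noncomputable def outerVar : (Laurent (Laurent k))⟦X⟧ := PowerSeries.C (Laurent.single (-1) 1)

/-- The inner variable `u` of the ring of expansions. -/
noncomputable def innerVar : (Laurent (Laurent k))⟦X⟧ :=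
  PowerSeries.C (Laurent.C (Laurent.single (-1) 1))

/-- The residue of the expansion of a rational function satisfies a linear differential equation. -/
theorem exists_relation_of_rational [CharZero k] {F p q : (Laurent (Laurent k))⟦X⟧}
    (hq : q ≠ 0) (hF : q * F = p)
    (hpm : p ∈ Algebra.adjoin k {PowerSeries.X, innerVar k, outerVar k})
    (hqm : q ∈ Algebra.adjoin k {PowerSeries.X, innerVar k, outerVar k}) :
    ∃ (n : ℕ) (c : Fin n → Fin n → k), (∃ a b, c a b ≠ 0) ∧
      ∑ a, ∑ b, c a b • (PowerSeries.X ^ (a : ℕ) * (PowerSeries.derivative k)^[b] (residue k F))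
        = 0 := by
  refine exists_relation_residue (dt := timeDerivation k (Laurent (Laurent k)))
    (du := powerSeriesMapDerivation (Laurent.mapDerivation (Laurent.derivation k k)))
    (dv := powerSeriesMapDerivation (Laurent.derivation k (Laurent k)))
    ?_ ?_ ?_ ?_ ?_ ?_ ?_ ?_ ?_ ?_ ?_ ?_ ?_ hq hF hpm hqm
  · rw [timeDerivation_apply, PowerSeries.derivative_X]
  · rw [timeDerivation_apply, innerVar, PowerSeries.derivative_C]
  · rw [timeDerivation_apply, outerVar, PowerSeries.derivative_C]
  · rw [powerSeriesMapDerivation_X]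
  · rw [innerVar, powerSeriesMapDerivation_C, Laurent.C_eq_single, Laurent.mapDerivation_single,
      Laurent.derivation_single, Laurent.single_zero_one, map_one]
  · rw [outerVar, powerSeriesMapDerivation_C, Laurent.mapDerivation_single,
      Derivation.map_one_eq_zero,
      Laurent.single_zero, map_zero]
  · rw [powerSeriesMapDerivation_X]
  · rw [innerVar, powerSeriesMapDerivation_C, Laurent.derivation_C, map_zero]
  · rw [outerVar, powerSeriesMapDerivation_C, Laurent.derivation_single, map_one]
  · intro G
    ext n
    rw [coeff_residue, coeff_powerSeriesMapDerivation, Laurent.coeff_mapDerivation,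
      Laurent.coeff_derivation]
    simp
  · intro G
    ext n
    rw [coeff_residue, coeff_powerSeriesMapDerivation, Laurent.coeff_derivation]
    simp [Laurent.coeff_zero]
  · intro G
    ext n
    rw [coeff_residue]
    cases n with
    | zero => simp [Laurent.coeff_zero]
    | succ n => rw [PowerSeries.coeff_succ_X_mul, PowerSeries.coeff_succ_X_mul, coeff_residue]
  · intro G
    ext n
    rw [coeff_residue, timeDerivation_apply, PowerSeries.coeff_derivative,
      PowerSeries.coeff_derivative, coeff_residue]
    have hn : ((n : Laurent (Laurent k)) + 1) = Laurent.C (Laurent.C ((n : k) + 1)) := by simp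
    rw [hn, mul_comm, Laurent.coeff_C_mul, Laurent.coeff_C_mul, mul_comm]

end Expansion

end QuarterPlane

namespace QuarterPlane

/-! ### The orbit sum as a rational function -/

namespace Laurent

variable {A : Type*} [CommRing A]

/-- The variable `u = w⁻¹` as a unit. -/
noncomputable def unitVar (A : Type*) [CommRing A] : (Laurent A)ˣ :=
  ⟨single (-1) 1, single 1 1, by rw [single_mul_single]; simp [single_zero_one],
    by rw [single_mul_single]; simp [single_zero_one]⟩

theorem unitVar_zpow (n : ℤ) : ((unitVar A ^ n : (Laurent A)ˣ) : Laurent A) = single (-n) 1 := by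
  induction n using Int.induction_on with
  | zero => simp [single_zero_one]
  | succ n ih =>
    rw [zpow_add, zpow_one, Units.val_mul, ih, unitVar, single_mul_single, one_mul]
    congr 1; ring
  | pred n ih =>
    rw [zpow_sub, zpow_one, Units.val_mul, ih, unitVar, Units.inv_mk, single_mul_single, one_mul]
    congr 1; ring

end Laurent

/-! ### Expansion of x and y at infinity, and the Cauchy kernel. -/

section Expand

variable (k : Type*) [Field k] [Algebra ℂ k]

/-- The evaluation of polynomials at the variable of Laurent series. -/
noncomputable def evalVar : Polynomial ℂ →+* Laurent k :=
  Polynomial.eval₂RingHom (Laurent.C.comp (algebraMap ℂ k)) (Laurent.single (-1) 1)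

theorem coeff_evalVar (p : Polynomial ℂ) (n : ℕ) :
    (evalVar k p).coeff (-n) = algebraMap ℂ k (p.coeff n) := by
  induction p using Polynomial.induction_on' with
  | add p q hp hq => rw [map_add, Laurent.coeff_add, hp, hq, Polynomial.coeff_add, map_add]
  | monomial m c =>
    have h : (Laurent.single (-1) (1 : k)) ^ m = Laurent.single (-m) 1 := by
      rw [← Laurent.unitVar_zpow (m : ℤ), zpow_natCast, Units.val_pow_eq_pow_val]; rfl
    rw [evalVar, Polynomial.coe_eval₂RingHom, Polynomial.eval₂_monomial, h, RingHom.comp_apply,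
      Laurent.coeff_C_mul, Laurent.coeff_single, Polynomial.coeff_monomial]
    by_cases hm : m = n
    · simp [hm]
    · rw [if_neg (by omega), if_neg hm, mul_zero, map_zero]

theorem evalVar_injective : Function.Injective (evalVar k) := by
  rw [injective_iff_map_eq_zero]
  intro p hp
  ext n
  have := coeff_evalVar k p n
  rw [hp, Laurent.coeff_zero] at this
  simpa using this.symm

/-- The expansion of rational functions at infinity. -/
noncomputable def expandX : RatFunc ℂ →+* Laurent k :=
  RatFunc.liftRingHom (evalVar k)
    (nonZeroDivisors_le_comap_nonZeroDivisors_of_injective _ (evalVar_injective k))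

theorem expandX_algebraMap (c : ℂ) :
    expandX k (algebraMap ℂ (RatFunc ℂ) c) = Laurent.C (algebraMap ℂ k c) := by
  rw [IsScalarTower.algebraMap_apply ℂ (Polynomial ℂ) (RatFunc ℂ), expandX,
    RatFunc.liftRingHom_algebraMap, Polynomial.algebraMap_eq, evalVar, Polynomial.coe_eval₂RingHom,
    Polynomial.eval₂_C, RingHom.comp_apply]

theorem expandX_X : expandX k RatFunc.X = Laurent.single (-1) 1 := by
  rw [← RatFunc.algebraMap_X, expandX, RatFunc.liftRingHom_algebraMap, evalVar,
    Polynomial.coe_eval₂RingHom, Polynomial.eval₂_X]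

theorem expandX_zpow (i : ℤ) : expandX k (RatFunc.X ^ i) = Laurent.single (-i) 1 := by
  rw [map_zpow₀, expandX_X, ← Laurent.unitVar_zpow i, Units.val_zpow_eq_zpow_val]
  rfl

/-- The expansion of `ℂ(x)[y, y⁻¹]` in iterated Laurent series at infinity. -/
noncomputable def expandXY : (RatFunc ℂ)[T;T⁻¹] →+* Laurent (Laurent k) :=
  LaurentPolynomial.eval₂ (Laurent.C.comp (expandX k)) (Laurent.unitVar (Laurent k))

theorem expandXY_C (r : RatFunc ℂ) :
    expandXY k (LaurentPolynomial.C r) = Laurent.C (expandX k r) := by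
  rw [expandXY, LaurentPolynomial.eval₂_C, RingHom.comp_apply]

theorem expandXY_T (j : ℤ) :
    expandXY k (LaurentPolynomial.T j) = Laurent.single (-j) 1 := by
  rw [expandXY, LaurentPolynomial.eval₂_T, Laurent.unitVar_zpow]

variable {k} (x y : k)

/-- The expansion of `1 / (u v (u - x) (v - y))`. -/
noncomputable def cauchyKernel : Laurent (Laurent k) :=
  Laurent.C (Laurent.geometric x * Laurent.single 1 1)
    * (Laurent.geometric (Laurent.C y) * Laurent.single 1 1)

/-- The double residue against the Cauchy kernel. -/
noncomputable def cauchyResidue : (RatFunc ℂ)[T;T⁻¹] →+ k where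
  toFun W := ((expandXY k W * cauchyKernel x y).coeff 1).coeff 1
  map_zero' := by rw [map_zero, zero_mul, Laurent.coeff_zero, Laurent.coeff_zero]
  map_add' W W' := by rw [map_add, add_mul, Laurent.coeff_add, Laurent.coeff_add]

theorem cauchyResidue_apply (W : (RatFunc ℂ)[T;T⁻¹]) :
    cauchyResidue x y W = ((expandXY k W * cauchyKernel x y).coeff 1).coeff 1 := rfl

theorem cauchyResidue_C_mul_T (r : RatFunc ℂ) (j : ℤ) :
    cauchyResidue x y (LaurentPolynomial.C r * LaurentPolynomial.T j)
      = if 1 ≤ j then (expandX k r * (Laurent.geometric x * Laurent.single 1 1)).coeff 1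
        * y ^ (j - 1).toNat else 0 := by
  have h : expandXY k (LaurentPolynomial.C r * LaurentPolynomial.T j) * cauchyKernel x y
      = Laurent.C (expandX k r * (Laurent.geometric x * Laurent.single 1 1))
        * (Laurent.single (1 - j) 1 * Laurent.geometric (Laurent.C y)) := by
    have e : (Laurent.single (1 - j) 1 : Laurent (Laurent k))
        = Laurent.single (-j) 1 * Laurent.single 1 1 := by
      rw [Laurent.single_mul_single, one_mul]; congr 1; ring
    rw [map_mul, expandXY_C, expandXY_T, cauchyKernel, e]
    simp only [map_mul]
    ring
  rw [cauchyResidue_apply, h, Laurent.coeff_C_mul, Laurent.coeff_single_mul,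
    Laurent.coeff_geometric, one_mul, sub_sub_cancel]
  split_ifs
  · rw [← map_pow, mul_comm, Laurent.coeff_C_mul, mul_comm]
  · rw [mul_zero, Laurent.coeff_zero]

/-- The kernel expands as a double geometric series, of which a single term meets the residue. The
outcome is the positive part divided by x y, evaluated at the point (x, y) of the base field. -/
theorem cauchyResidue_monomial (c : ℂ) (i j : ℤ) :
    cauchyResidue x y (inclXY (monoXY c i j)) = if 1 ≤ i ∧ 1 ≤ j then
      algebraMap ℂ k c * x ^ (i - 1).toNat * y ^ (j - 1).toNat else 0 := by
  have h : expandX k (algebraMap ℂ (RatFunc ℂ) c * RatFunc.X ^ i)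
      * (Laurent.geometric x * Laurent.single 1 1)
      = Laurent.C (algebraMap ℂ k c) * (Laurent.single (1 - i) 1 * Laurent.geometric x) := by
    have e : (Laurent.single (1 - i) 1 : Laurent k)
        = Laurent.single (-i) 1 * Laurent.single 1 1 := by
      rw [Laurent.single_mul_single, one_mul]; congr 1; ring
    rw [map_mul, expandX_algebraMap, expandX_zpow, e]
    ring
  rw [inclXY_monoXY, cauchyResidue_C_mul_T, h, Laurent.coeff_C_mul, Laurent.coeff_single_mul,
    Laurent.coeff_geometric, one_mul, sub_sub_cancel]
  by_cases hj : 1 ≤ j <;> by_cases hi : 1 ≤ i <;> simp [hi, hj]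

theorem shifted_eq_sum (a : Model) (n : ℕ) : shifted a n = ∑ i ∈ Finset.range (n + 1),
    ∑ j ∈ Finset.range (n + 1), monoXY (walks a n i j) (i + 1) (j + 1) := by
  rw [shifted, coeff_polyInclusion, Finset.mul_sum]
  simp only [Finset.mul_sum, monoXY_mul, one_mul, add_comm (1 : ℤ)]

variable {l : ℂ} (hl : l ≠ 0) {a : Model} (ha : Interesting a) (h : Proportional a l)

/-- The exponent of y becomes `-j ≤ 0`, so the residue in the outer variable vanishes whatever the
rational coefficient in x is. Its poles therefore do no harm. -/
theorem cauchyResidue_flipY (c : ℂ) (i : ℤ) {j : ℤ} (hj : 0 ≤ j) :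
    cauchyResidue x y (flipY ha h (inclXY (monoXY c i j))) = 0 := by
  rw [inclXY_monoXY, flipY, map_mul, flipT_C, flipT_T, ← mul_assoc, ← map_mul,
    cauchyResidue_C_mul_T, if_neg (by omega)]

theorem cauchyResidue_fullOrbit (n : ℕ) :
    cauchyResidue x y (fullOrbit hl ha h n) = ∑ i ∈ Finset.range (n + 1),
      ∑ j ∈ Finset.range (n + 1), algebraMap ℂ k (walks a n i j) * x ^ i * y ^ j := by
  rw [fullOrbit, halfOrbit, shifted_eq_sum]
  simp only [map_sub, map_sum, flipX_monoXY]
  have h1 : ∀ (c : ℂ) (i : ℤ) (j : ℕ),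
      cauchyResidue x y (flipY ha h (inclXY (monoXY c i (j + 1)))) = 0 :=
    fun c i j => cauchyResidue_flipY x y ha h c i (by omega)
  have h2 : ∀ (c : ℂ) (i j : ℕ),
      cauchyResidue x y (inclXY (monoXY c (-((i : ℤ) + 1)) (j + 1))) = 0 := fun c i j => by
    rw [cauchyResidue_monomial, if_neg (by omega)]
  have h3 : ∀ (c : ℂ) (i j : ℕ), cauchyResidue x y (inclXY (monoXY c (i + 1) (j + 1)))
      = algebraMap ℂ k c * x ^ i * y ^ j := fun c i j => by
    rw [cauchyResidue_monomial, if_pos (by omega)]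
    simp
  simp only [h1, h2, h3, Finset.sum_const_zero, sub_zero]

end Expand

end QuarterPlane

namespace QuarterPlane

/-! ### A differential equation over the field of rational functions -/

section Equation

variable {k : Type*} [Field k] (x y : k)

/-- The denominator of the Cauchy kernel. -/
noncomputable def cauchyDenominator : Laurent (Laurent k) :=
  Laurent.C (Laurent.single (-1) 1 * (Laurent.single (-1) 1 - Laurent.C x))
    * (Laurent.single (-1) 1 * (Laurent.single (-1) 1 - Laurent.C (Laurent.C y)))

theorem cauchyDenominator_mul_cauchyKernel : cauchyDenominator x y * cauchyKernel x y = 1 := by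
  have h : ∀ {A : Type _} [CommRing A] (z : A), (Laurent.single (-1) 1
      * (Laurent.single (-1) 1 - Laurent.C z)) * (Laurent.geometric z * Laurent.single 1 1)
      = 1 := by
    intro A _ z
    rw [mul_comm (Laurent.geometric z), mul_mul_mul_comm, Laurent.sub_mul_geometric,
      Laurent.single_mul_single, mul_one, mul_one]
    exact Laurent.single_zero_one
  rw [cauchyDenominator, cauchyKernel, mul_mul_mul_comm, ← map_mul, h, h, map_one, one_mul]

theorem algebraMap_expansion (r : k) : algebraMap k (Laurent (Laurent k))⟦X⟧ r
    = PowerSeries.C (Laurent.C (Laurent.C r)) := by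
  rw [PowerSeries.algebraMap_apply, Laurent.algebraMap_eq, Laurent.algebraMap_eq]
  rfl

theorem cauchyDenominator_mem : PowerSeries.C (cauchyDenominator x y)
    ∈ Algebra.adjoin k {PowerSeries.X, innerVar k, outerVar k} := by
  have h : PowerSeries.C (cauchyDenominator x y) = innerVar k * (innerVar k - algebraMap k _ x)
      * (outerVar k * (outerVar k - algebraMap k _ y)) := by
    simp only [cauchyDenominator, map_mul, map_sub, algebraMap_expansion, innerVar, outerVar]
  rw [h]
  have h1 : innerVar k ∈ Algebra.adjoin k {PowerSeries.X, innerVar k, outerVar k} :=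
    Algebra.subset_adjoin (by simp)
  have h2 : outerVar k ∈ Algebra.adjoin k {PowerSeries.X, innerVar k, outerVar k} :=
    Algebra.subset_adjoin (by simp)
  exact mul_mem (mul_mem h1 (sub_mem h1 (Subalgebra.algebraMap_mem _ _)))
    (mul_mem h2 (sub_mem h2 (Subalgebra.algebraMap_mem _ _)))

variable [Algebra ℂ k]

variable (k) in
/-- The expansion of `ℂ(x)[y, y⁻¹]` in the constant power series. -/
noncomputable def expandConst : (RatFunc ℂ)[T;T⁻¹] →+* (Laurent (Laurent k))⟦X⟧ :=
  PowerSeries.C.comp (expandXY k)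

theorem expandConst_X : expandConst k (LaurentPolynomial.C RatFunc.X) = innerVar k := by
  rw [expandConst, RingHom.comp_apply, expandXY_C, expandX_X, innerVar]

theorem expandConst_T : expandConst k (LaurentPolynomial.T 1) = outerVar k := by
  rw [expandConst, RingHom.comp_apply, expandXY_T, outerVar]

theorem expandConst_algebraMap (c : ℂ) :
    expandConst k (LaurentPolynomial.C (algebraMap ℂ (RatFunc ℂ) c))
      = algebraMap k _ (algebraMap ℂ k c) := by
  rw [expandConst, RingHom.comp_apply, expandXY_C, expandX_algebraMap,
    algebraMap_expansion]

variable (k) in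
/-- The subring of the elements with polynomial expansion. -/
noncomputable def polynomialExpansion : Subring (RatFunc ℂ)[T;T⁻¹] :=
  (Algebra.adjoin k {PowerSeries.X, innerVar k, outerVar k}).toSubring.comap (expandConst k)

theorem mem_polynomialExpansion {W : (RatFunc ℂ)[T;T⁻¹]} : W ∈ polynomialExpansion k ↔
    expandConst k W ∈ Algebra.adjoin k {PowerSeries.X, innerVar k, outerVar k} := Iff.rfl

theorem C_X_mem : LaurentPolynomial.C RatFunc.X ∈ polynomialExpansion k := by
  rw [mem_polynomialExpansion, expandConst_X]
  exact Algebra.subset_adjoin (by simp)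

theorem T_mem (n : ℕ) : LaurentPolynomial.T n ∈ polynomialExpansion k := by
  have h : LaurentPolynomial.T 1 ∈ polynomialExpansion k := by
    rw [mem_polynomialExpansion, expandConst_T]
    exact Algebra.subset_adjoin (by simp)
  have := pow_mem h n
  rwa [LaurentPolynomial.T_pow, mul_one] at this

theorem C_algebraMap_mem (c : ℂ) :
    LaurentPolynomial.C (algebraMap ℂ (RatFunc ℂ) c) ∈ polynomialExpansion k := by
  rw [mem_polynomialExpansion, expandConst_algebraMap]
  exact Subalgebra.algebraMap_mem _ _

theorem step_mem (c : ℂ) {d : ℤ × ℤ} (hd : d ∈ directions) :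
    LaurentPolynomial.C RatFunc.X * LaurentPolynomial.T 1
      * (LaurentPolynomial.C (algebraMap ℂ (RatFunc ℂ) c * RatFunc.X ^ d.1)
        * LaurentPolynomial.T d.2) ∈ polynomialExpansion k := by
  obtain ⟨⟨m, hm⟩, n, hn⟩ : (∃ m : ℕ, (m : ℤ) = 1 + d.1) ∧ ∃ n : ℕ, (n : ℤ) = 1 + d.2 := by
    have : 0 ≤ 1 + d.1 ∧ 0 ≤ 1 + d.2 := by revert d; decide
    exact ⟨⟨_, Int.toNat_of_nonneg this.1⟩, _, Int.toNat_of_nonneg this.2⟩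
  have e : LaurentPolynomial.C RatFunc.X * LaurentPolynomial.T 1
      * (LaurentPolynomial.C (algebraMap ℂ (RatFunc ℂ) c * RatFunc.X ^ d.1)
        * LaurentPolynomial.T d.2) = LaurentPolynomial.C (algebraMap ℂ (RatFunc ℂ) c)
        * LaurentPolynomial.C RatFunc.X ^ m * LaurentPolynomial.T n := by
    rw [hn, LaurentPolynomial.T_add, ← map_pow, ← zpow_natCast, hm,
      zpow_add₀ RatFunc.X_ne_zero, zpow_one]
    simp only [map_mul]
    ring
  rw [e]
  exact mul_mem (mul_mem (C_algebraMap_mem c) (pow_mem C_X_mem m)) (T_mem n)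

/-- Steps have components at least -1, so multiplication by both variables clears all negative
powers. -/
theorem kernel_mem (a : Model) : innerVar k * outerVar k * PowerSeries.map (expandXY k) (kernel a)
    ∈ Algebra.adjoin k {PowerSeries.X, innerVar k, outerVar k} := by
  have h : innerVar k * outerVar k * PowerSeries.map (expandXY k) (kernel a)
      = innerVar k * outerVar k - PowerSeries.X * expandConst k (∑ d ∈ directions,
        LaurentPolynomial.C RatFunc.X * LaurentPolynomial.T 1
        * (LaurentPolynomial.C (algebraMap ℂ (RatFunc ℂ) (a d.1 d.2) * RatFunc.X ^ d.1)
        * LaurentPolynomial.T d.2)) := by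
    rw [← Finset.mul_sum, map_mul, map_mul, expandConst_X, expandConst_T, kernel, map_sub, map_one,
      map_mul, PowerSeries.map_X, PowerSeries.map_C, expandConst, RingHom.comp_apply]
    ring
  rw [h]
  refine sub_mem (mul_mem ?_ ?_) (mul_mem ?_ ?_)
  · exact Algebra.subset_adjoin (by simp)
  · exact Algebra.subset_adjoin (by simp)
  · exact Algebra.subset_adjoin (by simp)
  · exact mem_polynomialExpansion.1 (sum_mem fun d hd => step_mem _ hd)

theorem exists_relation_orbitSum [CharZero k] {l : ℂ} {a : Model} (ha : Interesting a)
    (h : Proportional a l) :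
    ∃ (n : ℕ) (c : Fin n → Fin n → k), (∃ i j, c i j ≠ 0) ∧
      ∑ i, ∑ j, c i j • (PowerSeries.X ^ (i : ℕ) * (PowerSeries.derivative k)^[j]
        (residue k (PowerSeries.map (expandXY k) (orbitSum a l)
          * PowerSeries.C (cauchyKernel x y)))) = 0 := by
  set N : (RatFunc ℂ)[T;T⁻¹] :=
    LaurentPolynomial.C (RatFunc.X ^ 2 - algebraMap ℂ (RatFunc ℂ) l) with hN
  obtain ⟨B, hB, hR⟩ : ∃ B ∈ polynomialExpansion k, orbitSum a l = PowerSeries.C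
      (LaurentPolynomial.C ((RatFunc.X ^ 2 - algebraMap ℂ (RatFunc ℂ) l)
        / (RatFunc.X * sideX a l 1)) * LaurentPolynomial.T (-1) * B) * kernelInv a := by
    -- `B` is the second factor in the definition of `orbitSum`, found by unification.
    refine ⟨_, ?_, rfl⟩
    simp only [map_mul, map_add, map_pow]
    have hT : LaurentPolynomial.T 2 ∈ polynomialExpansion k := T_mem 2
    have hX : LaurentPolynomial.C RatFunc.X ∈ polynomialExpansion k := C_X_mem
    have hc := C_algebraMap_mem (k := k)
    exact sub_mem (sub_mem (mul_mem (mul_mem (hc _) hX) hT) (mul_mem (hc _) hX))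
      (mul_mem (add_mem (hc _) (pow_mem hX 2)) (sub_mem (hc _) (mul_mem (hc _) hT)))
  have hD : RatFunc.X * sideX a l 1 ≠ 0 := mul_ne_zero RatFunc.X_ne_zero (sideX_one_ne_zero ha h)
  have hcancel : LaurentPolynomial.C (RatFunc.X * sideX a l 1) * LaurentPolynomial.T 1
      * (LaurentPolynomial.C ((RatFunc.X ^ 2 - algebraMap ℂ (RatFunc ℂ) l)
        / (RatFunc.X * sideX a l 1)) * LaurentPolynomial.T (-1) * B) = N * B := by
    rw [mul_assoc (LaurentPolynomial.C _) (LaurentPolynomial.T (-1)), mul_mul_mul_comm, ← map_mul,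
      mul_div_cancel₀ _ hD, ← mul_assoc (LaurentPolynomial.T 1), ← LaurentPolynomial.T_add]
    simp [hN]
  have hu : IsUnit (innerVar k) := by
    rw [← expandConst_X]
    exact ((RatFunc.X_ne_zero).isUnit.map LaurentPolynomial.C).map _
  have hv : IsUnit (outerVar k) := by
    rw [← expandConst_T]
    exact (LaurentPolynomial.isUnit_T 1).map _
  have hK : PowerSeries.map (expandXY k) (kernel a) * PowerSeries.map (expandXY k) (kernelInv a)
      = 1 := by rw [← map_mul, kernel_mul_kernelInv, map_one]
  have hC : PowerSeries.C (cauchyDenominator x y) * PowerSeries.C (cauchyKernel x y) = 1 := by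
    rw [← map_mul, cauchyDenominator_mul_cauchyKernel, map_one]
  -- The denominator collects the kernel cleared by u v, the Cauchy denominator, and the denominator
  -- x y `sideX a l 1` of the prefactor. It is nonzero because every factor is a unit in the ring of
  -- expansions.
  refine exists_relation_of_rational k
    (q := innerVar k * outerVar k * PowerSeries.map (expandXY k) (kernel a)
      * PowerSeries.C (cauchyDenominator x y)
      * expandConst k (LaurentPolynomial.C (RatFunc.X * sideX a l 1) * LaurentPolynomial.T 1))
    (p := innerVar k * outerVar k * expandConst k (N * B)) ?_ ?_ ?_ ?_
  · refine IsUnit.ne_zero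
      ((((hu.mul hv).mul (.of_mul_eq_one _ hK)).mul (.of_mul_eq_one _ hC)).mul ?_)
    exact ((hD.isUnit.map LaurentPolynomial.C).mul (LaurentPolynomial.isUnit_T 1)).map _
  · rw [hR, ← hcancel, map_mul (PowerSeries.map _), PowerSeries.map_C,
      map_mul (expandConst k) (_ * _)]
    change _ * (expandConst k _ * _ * _) = _
    linear_combination (innerVar k * outerVar k * PowerSeries.C (cauchyDenominator x y)
      * expandConst k (LaurentPolynomial.C (RatFunc.X * sideX a l 1) * LaurentPolynomial.T 1)
      * expandConst k (LaurentPolynomial.C ((RatFunc.X ^ 2 - algebraMap ℂ (RatFunc ℂ) l)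
        / (RatFunc.X * sideX a l 1)) * LaurentPolynomial.T (-1) * B)
      * PowerSeries.C (cauchyKernel x y)) * hK + (innerVar k * outerVar k
      * expandConst k (LaurentPolynomial.C (RatFunc.X * sideX a l 1) * LaurentPolynomial.T 1)
      * expandConst k (LaurentPolynomial.C ((RatFunc.X ^ 2 - algebraMap ℂ (RatFunc ℂ) l)
        / (RatFunc.X * sideX a l 1)) * LaurentPolynomial.T (-1) * B)) * hC
  · refine mul_mem (mul_mem (Algebra.subset_adjoin (by simp)) (Algebra.subset_adjoin (by simp))) ?_
    refine mem_polynomialExpansion.1 (mul_mem ?_ hB)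
    rw [hN, map_sub, map_pow]
    exact sub_mem (pow_mem C_X_mem 2) (C_algebraMap_mem l)
  · refine mul_mem (mul_mem (kernel_mem a) (cauchyDenominator_mem x y)) ?_
    refine mem_polynomialExpansion.1 (mul_mem ?_ (T_mem 1))
    simp only [sideX, map_mul, map_add, map_pow]
    exact mul_mem C_X_mem (add_mem (mul_mem (C_algebraMap_mem _) (add_mem (C_algebraMap_mem _)
      (pow_mem C_X_mem 2))) (mul_mem (C_algebraMap_mem _) C_X_mem))

end Equation

end QuarterPlane

namespace QuarterPlane

/-! ### D-finiteness -/

section DFinite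

variable {R S : Type*} [CommRing R] [CommRing S]

theorem map_iterate_derivative (φ : R →+* S) (f : R⟦X⟧) (n : ℕ) :
    PowerSeries.map φ ((PowerSeries.derivative R)^[n] f)
      = (PowerSeries.derivative S)^[n] (PowerSeries.map φ f) := by
  induction n generalizing f with
  | zero => rfl
  | succ n ih =>
    rw [Function.iterate_succ_apply, ih, Function.iterate_succ_apply]
    congr 1
    ext m
    simp [PowerSeries.coeff_derivative]

theorem DFinite.map {f : R⟦X⟧} (hf : DFinite f) {φ : R →+* S} (hφ : Function.Injective φ) :
    DFinite (PowerSeries.map φ f) := by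
  obtain ⟨r, p, ⟨k, hk, hpk⟩, h⟩ := hf
  refine ⟨r, fun k => (p k).map φ, ⟨k, hk, (Polynomial.map_ne_zero_iff hφ).2 hpk⟩, ?_⟩
  have := congrArg (PowerSeries.map φ) h
  simpa only [map_sum, map_mul, map_zero, map_iterate_derivative, Polynomial.polynomial_map_coe]
    using this

theorem map_injective {φ : R →+* S} (hφ : Function.Injective φ) :
    Function.Injective (PowerSeries.map φ) := by
  intro f g h
  ext n
  apply hφ
  rw [← PowerSeries.coeff_map, ← PowerSeries.coeff_map, h]

theorem dFinite_of_relation {K : Type*} [Field K] [Algebra R K] [IsFractionRing R K] {f : R⟦X⟧}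
    {n : ℕ} {c : Fin n → Fin n → K} (hc : ∃ i j, c i j ≠ 0)
    (h : ∑ i, ∑ j, c i j • (PowerSeries.X ^ (i : ℕ)
      * (PowerSeries.derivative K)^[j] (PowerSeries.map (algebraMap R K) f)) = 0) :
    DFinite f := by
  obtain ⟨b, hb⟩ := IsLocalization.exist_integer_multiples_of_finite (nonZeroDivisors R)
    fun i : Fin n × Fin n => c i.1 i.2
  choose c' hc' using hb
  obtain ⟨i, j, hij⟩ := hc
  -- Common denominators are cleared by `b`. The sum in `DFinite` also includes the index `n`, which
  -- is padded with the zero polynomial.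
  refine ⟨n, fun k => if hk : k < n then
    ∑ i : Fin n, Polynomial.C (c' (i, ⟨k, hk⟩)) * Polynomial.X ^ (i : ℕ) else 0,
    ⟨j, j.2.le, ?_⟩, ?_⟩
  · beta_reduce
    rw [dif_pos j.2]
    intro h0
    have h1 := congrArg (fun p => Polynomial.coeff p i) h0
    simp only [Polynomial.finsetSum_coeff, Polynomial.coeff_C_mul_X_pow, Polynomial.coeff_zero,
      Fin.val_inj, Finset.sum_ite_eq, Finset.mem_univ, if_true] at h1
    have h2 := hc' (i, j)
    rw [h1, map_zero, Algebra.smul_def] at h2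
    refine mul_ne_zero ?_ hij h2.symm
    have := (algebraMap R K).domain_nontrivial
    exact IsLocalization.to_map_ne_zero_of_mem_nonZeroDivisors K le_rfl b.2
  · beta_reduce
    rw [Finset.sum_range_succ, dif_neg (lt_irrefl n), Polynomial.coe_zero, zero_mul, add_zero,
      Finset.sum_range]
    apply map_injective (IsFractionRing.injective R K)
    have h' := congrArg (algebraMap R K b • ·) h
    simp only [smul_zero] at h'
    rw [map_zero, ← h', Finset.sum_comm, map_sum, Finset.smul_sum]
    refine Finset.sum_congr rfl fun j _ => ?_
    rw [dif_pos j.2, map_mul, map_iterate_derivative, ← Polynomial.polynomial_map_coe,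
      Polynomial.map_sum, ← Polynomial.coeToPowerSeries.ringHom_apply, map_sum, Finset.sum_mul,
      Finset.smul_sum]
    refine Finset.sum_congr rfl fun i _ => ?_
    rw [Polynomial.coeToPowerSeries.ringHom_apply, smul_smul, ← Algebra.smul_def, ← hc' (i, j),
      PowerSeries.smul_eq_C_mul]
    simp [mul_assoc]

end DFinite

/-- The base field is ℂ(x, y) itself, so x and y are constants for the derivations in u and v and
serve as the evaluation point of the Cauchy kernel. -/
theorem residue_orbitSum {l : ℂ} (hl : l ≠ 0) {a : Model} (ha : Interesting a)
    (h : Proportional a l) :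
    residue RatXY (PowerSeries.map (expandXY RatXY) (orbitSum a l)
      * PowerSeries.C (cauchyKernel x y)) = PowerSeries.map (algebraMap Poly RatXY) (genFun a) := by
  ext n
  rw [coeff_residue, PowerSeries.coeff_mul_C, PowerSeries.coeff_map, ← cauchyResidue_apply,
    coeff_orbitSum hl ha h, cauchyResidue_fullOrbit, PowerSeries.coeff_map, genFun,
    PowerSeries.coeff_mk, map_sum]
  simp only [map_sum, map_mul, map_pow, x, y, ← MvPolynomial.algebraMap_eq,
    ← IsScalarTower.algebraMap_apply]

theorem dFinite_genFun {l : ℂ} (hl : l ≠ 0) {a : Model} (ha : Interesting a)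
    (h : Proportional a l) : DFinite (genFun a) := by
  obtain ⟨n, c, hc, hR⟩ := exists_relation_orbitSum x y ha h
  rw [residue_orbitSum hl ha h] at hR
  exact dFinite_of_relation hc hR

/-! ### Reflection about the diagonal. -/

theorem walks_reflect (a : Model) (n : ℕ) (i j : ℤ) : walks a.reflect n i j = walks a n j i := by
  induction n generalizing i j with
  | zero => simp only [walks, and_comm]
  | succ n ih =>
    simp only [walks, and_comm (a := 0 ≤ i), sum_directions, ih, Model.reflect]
    congr 1
    ring

theorem genFun_reflect (a : Model) : genFun a.reflect
    = PowerSeries.map (MvPolynomial.rename (Equiv.swap (0 : Fin 2) 1)).toRingHom (genFun a) := by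
  ext n : 1
  rw [PowerSeries.coeff_map, genFun, genFun, PowerSeries.coeff_mk, PowerSeries.coeff_mk,
    Finset.sum_comm]
  simp only [walks_reflect, AlgHom.toRingHom_eq_coe, RingHom.coe_coe, map_sum, map_mul, map_pow,
    MvPolynomial.rename_C, MvPolynomial.rename_X, Equiv.swap_apply_left, Equiv.swap_apply_right]
  exact Finset.sum_congr rfl fun i _ => Finset.sum_congr rfl fun j _ => by ring

theorem Interesting.reflect {a : Model} (ha : Interesting a) : Interesting a.reflect := by
  simp only [Interesting, Uninteresting, Model.reflect] at ha ⊢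
  tauto

theorem dFinite_genFun_of_reflect {l : ℂ} (hl : l ≠ 0) {a : Model} (ha : Interesting a)
    (h : Proportional a.reflect l) : DFinite (genFun a) := by
  have := (dFinite_genFun hl ha.reflect h).map
    (φ := (MvPolynomial.rename (Equiv.swap (0 : Fin 2) 1)).toRingHom)
    (MvPolynomial.rename_injective _ (Equiv.injective _))
  rwa [← genFun_reflect] at this

end QuarterPlane

theorem theorem1 (a : QuarterPlane.Model) (ha : QuarterPlane.Interesting a) :
    (Nonempty (QuarterPlane.modelGroup a ha ≃* DihedralGroup 2) ↔
      (∃ l : ℂ, l ≠ 0 ∧ QuarterPlane.Proportional a l) ∨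
        ∃ l : ℂ, l ≠ 0 ∧ QuarterPlane.Proportional a.reflect l) ∧
    (Nonempty (QuarterPlane.modelGroup a ha ≃* DihedralGroup 2) →
      QuarterPlane.DFinite (QuarterPlane.genFun a)) ∧
    (∀ l : ℂ, l ≠ 0 → QuarterPlane.Proportional a l →
      QuarterPlane.IsPositivePart (QuarterPlane.genFun a) (QuarterPlane.orbitSum a l)) := by
  refine ⟨QuarterPlane.nonempty_mulEquiv_iff ha, fun h => ?_,
    fun l hl h => QuarterPlane.isPositivePart_orbitSum hl ha h⟩
  obtain ⟨l, hl, h⟩ | ⟨l, hl, h⟩ := (QuarterPlane.nonempty_mulEquiv_iff ha).1 h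
  · exact QuarterPlane.dFinite_genFun hl ha h
  · exact QuarterPlane.dFinite_genFun_of_reflect hl ha h
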